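/- Let $\mathbb F_q$ be a finite field of characteristic $p$, let $k=\overline{\mathbb F}_q$, and let $\mathcal X\subset\mathbb P^n(k)$ be an irreducible projective curve defined over $\mathbb F_q$. At a nonsingular point $P\in\mathcal X$, the order sequence of $P$ consists of all finite intersection multiplicities at $P$ of $\mathcal X$ with hyperplanes of $\mathbb P^n(k)$. Suppose that $\mathcal X$ has an order sequence $\varepsilon_0<\dots<\varepsilon_n$ (the order sequence of all but finitely many points of $\mathcal X$; it exists when $\mathcal X$ is not contained in a hyperplane). Let $\mathcal X^\circ$ be the set of nonsingular points of $\mathcal X$ with this order sequence, let $\gamma$ be the strict Gauss map, which sends $P\in\mathcal X^\circ$ to the point of the dual projective space given by the osculating hyperplane $H_P$ (the hyperplane that meets $\mathcal X$ at $P$ with multiplicity $\varepsilon_n$), and let the strict dual $\mathcal X'$ be the Zariski closure of $\gamma(\mathcal X^\circ)$. Assume that $\varepsilon_n=p^r$, and let $\gamma=\Phi_{p^r}\circ\gamma_s$, where $\Phi_{p^r}$ is the $p^r$-power Frobenius map and $\gamma_s=(z_0:\dots:z_n)$ is separable; that is, $z_0,\dots,z_n\in k(\mathcal X)$ satisfy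 $\gamma=(z_0^{p^r}:\dots:z_n^{p^r})$ on $\mathcal X^\circ$, and $k(\mathcal X)$ is separable over $k(\gamma_s(\mathcal X))=k(z_i/z_j : z_j\neq 0)$. Let $G$ be a nontrivial group of automorphisms of $\mathcal X$ (regarded as automorphisms of $k(\mathcal X)$ over $k$), all of them linear, i.e. induced by invertible linear transformations of $\mathbb P^n(k)$ that preserve $\mathcal X$. If $\gamma_s(\mathcal X)$ is a subcover of the quotient curve $\mathcal X/G$, i.e. $k(\gamma_s(\mathcal X))\subseteq k(\mathcal X)^G$, then $\mathcal X'$ is degenerate, i.e. contained in a hyperplane of the dual projective space. In particular, if $n=2$, then $\mathcal X$ is strange, i.e. all tangent lines to $\mathcal X$ at nonsingular points pass through a common point. -/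

import Mathlib

open MvPolynomial
open scoped LinearAlgebra.Projectivization

noncomputable section

namespace StrictDual

/-- Points of `n`-dimensional projective space over `k`, with homogeneous coordinates indexed by
`0, ..., n`. A point `H` is also used to denote the hyperplane `∑ i, H i * X i = 0`, which
identifies the dual projective space with `PSpace k n`. -/
abbrev PSpace (k : Type*) [Field k] (n : ℕ) : Type _ := ℙ k (Fin (n + 1) → k)

section Ideals

variable {k : Type*} [Field k] {n : ℕ} (I : Ideal (MvPolynomial (Fin (n + 1)) k)) [I.IsPrime]

/-- The fraction field of the homogeneous coordinate ring `k[X_0, ..., X_n] / I`. -/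
abbrev ConeField : Type _ := FractionRing (MvPolynomial (Fin (n + 1)) k ⧸ I)

/-- The class of a polynomial in the fraction field of the homogeneous coordinate ring. -/
def toCone : MvPolynomial (Fin (n + 1)) k →ₐ[k] ConeField I :=
  (IsScalarTower.toAlgHom k (MvPolynomial (Fin (n + 1)) k ⧸ I) (ConeField I)).comp
    (Ideal.Quotient.mkₐ k I)

/-- The function field `k(x_i / x_j)` of the projective variety with homogeneous prime ideal `I`,
inside the fraction field of the homogeneous coordinate ring. -/
def funField : IntermediateField k (ConeField I) :=
  IntermediateField.adjoin k {f | ∃ i j, f = toCone I (X i) / toCone I (X j)}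

/-- The length of the quotient ring `R / J`. -/
def quotLength {R : Type*} [CommRing R] (J : Ideal R) : ℕ∞ := Module.length R (R ⧸ J)

end Ideals

/-- An irreducible projective curve in `n`-dimensional projective space, given by its homogeneous
prime ideal. It has dimension one, that is, its function field has transcendence degree one. -/
structure ProjCurve (k : Type*) [Field k] (n : ℕ) where
  ideal : Ideal (MvPolynomial (Fin (n + 1)) k)
  isPrime : ideal.IsPrime
  isHomogeneous : ∀ F ∈ ideal, ∀ d, homogeneousComponent d F ∈ ideal
  trdeg_eq_one : Algebra.trdeg k (funField ideal) = 1

namespace ProjCurve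

variable {k : Type*} [Field k] {n : ℕ} (C : ProjCurve k n)

instance : C.ideal.IsPrime := C.isPrime

/-- The set of points of the curve. -/
def points : Set (PSpace k n) :=
  {P | ∀ (d : ℕ) (F : MvPolynomial (Fin (n + 1)) k),
    F.IsHomogeneous d → F ∈ C.ideal → eval P.rep F = 0}

/-- The curve is defined over the subfield `F`: its ideal is generated by polynomials with
coefficients in `F`. -/
def IsDefinedOver (F : Type*) [Field F] [Algebra F k] : Prop :=
  ∃ S : Set (MvPolynomial (Fin (n + 1)) F),
    C.ideal = Ideal.span (MvPolynomial.map (algebraMap F k) '' S)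

/-- The function field `k(C)`. -/
abbrev K : Type _ := funField C.ideal

/-- The coordinate quotient `x_i / x_j` in `k(C)`. -/
def ratio (i j : Fin (n + 1)) : C.K :=
  ⟨toCone C.ideal (X i) / toCone C.ideal (X j),
    IntermediateField.subset_adjoin k _ ⟨i, j, rfl⟩⟩

/-- The rational function `f` is regular at `P` with value `c`: it can be written as `a / b` with
homogeneous polynomials `a`, `b` of the same degree such that `b` does not vanish at `P`, and
`c = a(P) / b(P)`. -/
def HasValueAt (P : PSpace k n) (f : C.K) (c : k) : Prop :=
  ∃ (d : ℕ) (a b : MvPolynomial (Fin (n + 1)) k),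
    a.IsHomogeneous d ∧ b.IsHomogeneous d ∧ eval P.rep b ≠ 0 ∧
    (f : ConeField C.ideal) * toCone C.ideal b = toCone C.ideal a ∧
    c = eval P.rep a / eval P.rep b

/-- The local ring of the curve at `P`: the rational functions that are regular at `P`. -/
def localRing (P : PSpace k n) : Subalgebra k C.K where
  carrier := {f | ∃ c, C.HasValueAt P f c}
  mul_mem' := by
    rintro f g ⟨_, d, a, b, ha, hb, hP, hf, -⟩ ⟨_, e, a', b', ha', hb', hP', hg, -⟩
    refine ⟨_, d + e, a * a', b * b', ha.mul ha', hb.mul hb', ?_, ?_, rfl⟩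
    · rw [map_mul]
      exact mul_ne_zero hP hP'
    · rw [map_mul, map_mul, ← hf, ← hg]
      push_cast
      ring
  add_mem' := by
    rintro f g ⟨_, d, a, b, ha, hb, hP, hf, -⟩ ⟨_, e, a', b', ha', hb', hP', hg, -⟩
    refine ⟨_, d + e, a * b' + b * a', b * b', (ha.mul hb').add (hb.mul ha'), hb.mul hb',
      ?_, ?_, rfl⟩
    · rw [map_mul]
      exact mul_ne_zero hP hP'
    · rw [map_add, map_mul, map_mul, map_mul, ← hf, ← hg]
      push_cast
      ring
  algebraMap_mem' := by
    intro r
    refine ⟨_, 0, MvPolynomial.C r, 1, isHomogeneous_C _ _, isHomogeneous_one _ _, ?_, ?_, rfl⟩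
    · simp
    · rw [map_one, mul_one]
      exact ((toCone C.ideal).commutes r).symm

/-- The point `P` of the curve is nonsingular: its local ring is a discrete valuation ring. -/
def IsNonsingularAt (P : PSpace k n) : Prop :=
  P ∈ C.points ∧ IsDiscreteValuationRing (C.localRing P)

/-- The linear form `∑ i, v i * X i`. -/
def linForm (v : Fin (n + 1) → k) : MvPolynomial (Fin (n + 1)) k :=
  ∑ i, MvPolynomial.C (v i) * X i

/-- The point `P` lies on the hyperplane `H`. -/
def OnHyperplane (P H : PSpace k n) : Prop := ∑ i, H.rep i * P.rep i = 0

/-- The ideal of the local ring at `P` generated by a local equation `ℓ / m` of the hyperplane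
`H : ℓ = 0`, where `m` is a linear form that does not vanish at `P`. (For a point `P` of the curve,
any two of the generators listed differ by a unit.) -/
def hyperplaneIdeal (P H : PSpace k n) : Ideal (C.localRing P) :=
  Ideal.span {f | ∃ m : Fin (n + 1) → k, ∑ i, m i * P.rep i ≠ 0 ∧
    ((f : C.K) : ConeField C.ideal) * toCone C.ideal (linForm m) =
      toCone C.ideal (linForm H.rep)}

/-- The intersection multiplicity at `P` of the curve with the hyperplane `H`: the length of the
local ring modulo a local equation of `H`. -/
def interMult (P H : PSpace k n) : ℕ∞ :=
  quotLength (C.hyperplaneIdeal P H)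

/-- The (finite) intersection multiplicities at `P` of the curve with hyperplanes. -/
def orders (P : PSpace k n) : Set ℕ := {m | ∃ H : PSpace k n, C.interMult P H = m}

/-- The nonsingular points `P` of the curve whose order sequence is `ε`. -/
def genericPoints (ε : Fin (n + 1) → ℕ) : Set (PSpace k n) :=
  {P | C.IsNonsingularAt P ∧ C.orders P = Set.range ε}

/-- `ε_0 < ... < ε_n` is the order sequence of the curve: it is the order sequence of all but
finitely many of its points. -/
def IsOrderSequence (ε : Fin (n + 1) → ℕ) : Prop :=
  StrictMono ε ∧ (C.points \ C.genericPoints ε).Finite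

/-- `H` is the osculating hyperplane at the generic point `P`, that is, `γ(P) = H` for the strict
Gauss map `γ`. -/
def IsGaussImage (ε : Fin (n + 1) → ℕ) (P H : PSpace k n) : Prop :=
  P ∈ C.genericPoints ε ∧ C.interMult P H = ε (Fin.last n)

end ProjCurve

/-- The Zariski closure of a set of points of projective space. -/
def zariskiClosure {k : Type*} [Field k] {n : ℕ} (s : Set (PSpace k n)) : Set (PSpace k n) :=
  {Q | ∀ (d : ℕ) (F : MvPolynomial (Fin (n + 1)) k), F.IsHomogeneous d →
    (∀ P ∈ s, eval P.rep F = 0) → eval Q.rep F = 0}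

/-- A set of points of projective space is degenerate if it is contained in a hyperplane. -/
def IsDegenerate {k : Type*} [Field k] {n : ℕ} (s : Set (PSpace k n)) : Prop :=
  ∃ v : Fin (n + 1) → k, v ≠ 0 ∧ ∀ Q ∈ s, ∑ i, v i * Q.rep i = 0

namespace ProjCurve

variable {k : Type*} [Field k] {n : ℕ} (C : ProjCurve k n)

/-- The strict dual curve: the Zariski closure, in the dual projective space, of the image of the
strict Gauss map. -/
def strictDual (ε : Fin (n + 1) → ℕ) : Set (PSpace k n) :=
  zariskiClosure {H | ∃ P, C.IsGaussImage ε P H}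

/-- The point `N` lies on the tangent line to the curve at the nonsingular point `P`. That line is
the intersection of all hyperplanes meeting the curve at `P` with multiplicity at least two. -/
def OnTangentLine (P N : PSpace k n) : Prop :=
  ∀ H : PSpace k n, 2 ≤ C.interMult P H → OnHyperplane N H

/-- The curve is strange: all its tangent lines at nonsingular points pass through one point. -/
def IsStrange : Prop :=
  ∃ N : PSpace k n, ∀ P, C.IsNonsingularAt P → C.OnTangentLine P N

/-- The rational map `(z_0 : ... : z_n)` is defined at `P` and sends `P` to `Q`: after
multiplication with some rational function, all `z_i` are regular at `P`, and their values are the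
homogeneous coordinates of `Q`. -/
def MapsPoint (z : Fin (n + 1) → C.K) (P Q : PSpace k n) : Prop :=
  ∃ g : C.K, ∀ i, C.HasValueAt P (g * z i) (Q.rep i)

/-- The function field `k(z_i / z_j)` of the image of the rational map `(z_0 : ... : z_n)`, as a
subfield of `k(C)`. -/
def imageField (z : Fin (n + 1) → C.K) : IntermediateField k C.K :=
  IntermediateField.adjoin k {f | ∃ i j, f = z i / z j}

/-- The rational map `γ_s = (z_0 : ... : z_n)` is the separable part of the strict Gauss map
`γ = Φ ∘ γ_s`, where `Φ` is the `p ^ r`-power Frobenius map: `γ = (z_0 ^ p ^ r : ... : z_n ^ p ^ r)`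
at all generic points, and `k(C)` is separable over the function field of the image of `γ_s`. -/
structure IsSeparableGauss (ε : Fin (n + 1) → ℕ) (p r : ℕ) (z : Fin (n + 1) → C.K) : Prop where
  gauss : ∀ P H, C.IsGaussImage ε P H → C.MapsPoint (fun i => z i ^ p ^ r) P H
  separable : Algebra.IsSeparable (C.imageField z) C.K

/-- The automorphism `σ` of the curve (of its function field) is linear: it is the pullback
`x_i / x_j ↦ (A x)_i / (A x)_j` along an invertible linear transformation `P ↦ A P` that maps the
curve to itself. -/
def IsLinearAut (σ : C.K ≃ₐ[k] C.K) : Prop :=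
  ∃ A : Matrix.GeneralLinearGroup (Fin (n + 1)) k,
    (∀ F ∈ C.ideal, aeval (fun i => linForm (A.1 i)) F ∈ C.ideal) ∧
    ∀ i j, toCone C.ideal (X j) ≠ 0 →
      (σ (C.ratio i j) : ConeField C.ideal) =
        toCone C.ideal (linForm (A.1 i)) / toCone C.ideal (linForm (A.1 j))

end ProjCurve

end StrictDual

end

noncomputable section

namespace StrictDual

/-! Write `q = p ^ r` and `z i = a i / b` with forms `a i`, `b` of one degree, so that the
osculating hyperplane at a generic `P` has coordinates proportional to `a i (P) ^ q`. It passes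
through `P`, hence `∑ a i ^ q * X i` vanishes on the curve (`sum_pow_mul_X_mem`). Conversely, let
`c` be any family of forms of one degree such that `∑ c i ^ q * X i` vanishes on the curve. By
additivity of Frobenius, the hyperplane with coordinates `c i (P) ^ q` has contact at least `q =
ε_n` at `P` (`germ_linForm_mem_pow`). At a generic point such a hyperplane is unique up to a scalar,
so `c` is proportional to `a` on the curve (`mul_sub_mul_mem`). Take `σ ≠ 1` in `G` with matrix `A`.
It fixes all `z i / z l`, so applying it to the relation produces the family `c = Bᵀ a`, where `B`
consists of the `q`-th roots of the entries of `A`. Thus `a` is an eigenvector of a constant matrix.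
Its eigenvalue `μ` is algebraic over `k`, hence constant, and `B` is not scalar because `σ ≠ 1`. A
nonzero column of `B - μ` is then a linear relation between the `a i` (`exists_sum_mul_mem`), and
its `q`-th power puts the dual curve in a hyperplane. For `n = 2` that hyperplane is a point `N` of
the original plane. The vector `a ^ q` is orthogonal to both `x` and `N`, hence parallel to `x × N`.
So ratios of lines through `N` are `q`-th powers, and the line joining `P ≠ N` to `N` has contact at
least `q ≥ 2`: it is the tangent (`isStrange_of_sum_mul_pow_mem`). -/

theorem IsHomogeneous.aeval_mul_left {k A σ : Type*} [CommSemiring k] [CommSemiring A]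
    [Algebra k A] {F : MvPolynomial σ k} {d : ℕ} (hF : F.IsHomogeneous d) (t : A) (y : σ → A) :
    aeval (fun i => t * y i) F = t ^ d * aeval y F := by
  rw [aeval_def, aeval_def, eval₂_eq, eval₂_eq, Finset.mul_sum]
  refine Finset.sum_congr rfl fun s hs => ?_
  rw [hF.degree_eq_sum_deg_support hs, Finset.prod_congr rfl fun _ _ => mul_pow t (y _) (s _),
    Finset.prod_mul_distrib, Finset.prod_pow_eq_pow_sum]
  ring

theorem IsHomogeneous.eval_mul_left {k σ : Type*} [CommSemiring k]
    {F : MvPolynomial σ k} {d : ℕ} (hF : F.IsHomogeneous d) (t : k) (y : σ → k) :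
    eval (fun i => t * y i) F = t ^ d * eval y F := by
  simpa [coe_aeval_eq_eval] using IsHomogeneous.aeval_mul_left hF t y

theorem aeval_self_eq_eval {k σ : Type*} [CommSemiring k] (x : σ → k) (F : MvPolynomial σ k) :
    aeval x F = eval x F := by
  rw [← coe_aeval_eq_eval]
  rfl

theorem isHomogeneous_linForm {k : Type*} [Field k] {n : ℕ} (v : Fin (n + 1) → k) :
    (ProjCurve.linForm v).IsHomogeneous 1 :=
  IsHomogeneous.sum _ _ _ fun _i _ => isHomogeneous_C_mul_X _ _

theorem aeval_linForm {k A : Type*} [Field k] [CommRing A] [Algebra k A] {n : ℕ}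
    (y : Fin (n + 1) → A) (v : Fin (n + 1) → k) :
    aeval y (ProjCurve.linForm v) = ∑ i, v i • y i := by
  simp [ProjCurve.linForm, Algebra.smul_def]

theorem eval_linForm {k : Type*} [Field k] {n : ℕ} (x v : Fin (n + 1) → k) :
    eval x (ProjCurve.linForm v) = ∑ i, v i * x i := by
  simp [ProjCurve.linForm]

theorem linForm_single {k : Type*} [Field k] {n : ℕ} (j : Fin (n + 1)) :
    ProjCurve.linForm (Pi.single j (1 : k)) = X j := by
  simp [ProjCurve.linForm, Pi.single_apply]

/-- A nonzero ideal is a power `M ^ t`, with quotient of length `t`. This turns bounds on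
intersection multiplicities into membership in powers of the maximal ideal. -/
theorem natCast_le_length_quotient_iff {R : Type*} [CommRing R] [IsDomain R]
    [IsDiscreteValuationRing R] (J : Ideal R) (s : ℕ) :
    (s : ℕ∞) ≤ Module.length R (R ⧸ J) ↔ J ≤ IsLocalRing.maximalIdeal R ^ s := by
  constructor
  · intro h
    obtain ⟨ϖ, hϖ⟩ := IsDiscreteValuationRing.exists_irreducible R
    by_cases hJ : J = ⊥
    · simp [hJ]
    obtain ⟨t, ht⟩ := IsDiscreteValuationRing.ideal_eq_span_pow_irreducible hJ hϖ
    have hJt : J = IsLocalRing.maximalIdeal R ^ t := by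
      rw [ht, hϖ.maximalIdeal_eq, Ideal.span_singleton_pow]
    rw [hJt, IsDiscreteValuationRing.length_quotient_pow_maximalIdeal] at h
    rw [hJt]
    exact Ideal.pow_le_pow_right (by exact_mod_cast h)
  · intro h
    rw [← IsDiscreteValuationRing.length_quotient_pow_maximalIdeal (R := R) s]
    exact Module.length_le_of_surjective (Submodule.factor h) (Submodule.factor_surjective h)

/-! ### The homogeneous coordinate ring: forms, points and rational functions -/

section ToCone

variable {k : Type*} [Field k] {n : ℕ} (C : ProjCurve k n)

theorem toCone_eq_zero_iff {F : MvPolynomial (Fin (n + 1)) k} :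
    toCone C.ideal F = 0 ↔ F ∈ C.ideal := by
  simp only [toCone, AlgHom.coe_comp, Function.comp_apply, IsScalarTower.coe_toAlgHom',
    Ideal.Quotient.mkₐ_eq_mk]
  rw [FaithfulSMul.algebraMap_eq_zero_iff, Ideal.Quotient.eq_zero_iff_mem]

theorem toCone_eq_aeval (F : MvPolynomial (Fin (n + 1)) k) :
    toCone C.ideal F = aeval (fun i => toCone C.ideal (X i)) F := by
  rw [← MvPolynomial.comp_aeval_apply, aeval_X_left_apply]

theorem toCone_linForm (v : Fin (n + 1) → k) :
    toCone C.ideal (ProjCurve.linForm v) = ∑ i, v i • toCone C.ideal (X i) := by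
  rw [toCone_eq_aeval, aeval_linForm]

theorem toCone_eq_pow_mul_aeval_ratio {F : MvPolynomial (Fin (n + 1)) k} {d : ℕ}
    (hF : F.IsHomogeneous d) {j : Fin (n + 1)} (hj : toCone C.ideal (X j) ≠ 0) :
    toCone C.ideal F = toCone C.ideal (X j) ^ d * (aeval (fun i => C.ratio i j) F : C.K) := by
  have h : ((aeval (fun i => C.ratio i j) F : C.K) : ConeField C.ideal) =
      aeval (fun i => toCone C.ideal (X i) / toCone C.ideal (X j)) F := by
    change (funField C.ideal).val _ = _
    rw [MvPolynomial.comp_aeval_apply]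
    rfl
  rw [h, ← IsHomogeneous.aeval_mul_left hF, toCone_eq_aeval]
  congr 2
  funext i
  field_simp

/-- Constant ratios would make the function field equal to `k`, of transcendence degree zero: the
curve is not a point. -/
theorem exists_ratio_ne : ¬ ∀ i j, ∃ c : k,
    toCone C.ideal (X i) / toCone C.ideal (X j) = algebraMap k _ c := by
  intro h
  have hb : funField C.ideal = ⊥ := by
    rw [funField, IntermediateField.adjoin_eq_bot_iff]
    rintro _ ⟨i, j, rfl⟩
    obtain ⟨c, hc⟩ := h i j
    rw [hc]
    exact IntermediateField.algebraMap_mem _ _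
  have h1 := C.trdeg_eq_one
  rw [hb] at h1
  have : Algebra.IsAlgebraic k (⊥ : IntermediateField k (ConeField C.ideal)) := inferInstance
  rw [trdeg_eq_zero_iff.2 this] at h1
  exact zero_ne_one h1

theorem exists_toCone_X_ne_zero : ∃ j, toCone C.ideal (X j) ≠ 0 := by
  by_contra! h
  exact exists_ratio_ne C fun i j => ⟨0, by simp [h]⟩

/-- For every point, some linear form through it does not vanish on the curve. -/
theorem exists_linForm_notMem (P : PSpace k n) : ∃ v : Fin (n + 1) → k,
    eval P.rep (ProjCurve.linForm v) = 0 ∧ ProjCurve.linForm v ∉ C.ideal := by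
  by_contra! h
  obtain ⟨l, hl⟩ : ∃ l, P.rep l ≠ 0 := by
    by_contra! h0
    exact P.rep_nonzero (funext h0)
  -- If every linear form through `P` vanished on the curve, all coordinates would be constant
  -- multiples of `X l`.
  have key : ∀ i, toCone C.ideal (X i) =
      algebraMap k _ (P.rep i / P.rep l) * toCone C.ideal (X l) := by
    intro i
    have h1 := (toCone_eq_zero_iff C).2 (h (Pi.single i 1 - (P.rep i / P.rep l) • Pi.single l 1) (by
      simp [eval_linForm, sub_mul, Finset.sum_sub_distrib, Pi.single_apply, hl]))
    simp [toCone_linForm, sub_smul, Finset.sum_sub_distrib, Pi.single_apply] at h1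
    rw [sub_eq_zero] at h1
    rw [h1, Algebra.smul_def, map_div₀]
  refine exists_ratio_ne C fun i j => ?_
  by_cases hX : toCone C.ideal (X l) = 0
  · exact ⟨0, by rw [key i, hX]; simp⟩
  refine ⟨(P.rep i / P.rep l) / (P.rep j / P.rep l), ?_⟩
  rw [key i, key j, map_div₀ _ (P.rep i / P.rep l), mul_div_mul_right _ _ hX]

/-- This is the Nullstellensatz on the affine cone. It is applied to `F * X j` instead of `F`, so
that the point found is not the origin. -/
theorem exists_point_eval_ne_zero [IsAlgClosed k] {F : MvPolynomial (Fin (n + 1)) k} {d : ℕ}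
    (hF : F.IsHomogeneous d) (hFI : F ∉ C.ideal) : ∃ P ∈ C.points, eval P.rep F ≠ 0 := by
  obtain ⟨j, hj⟩ := exists_toCone_X_ne_zero C
  have hG : F * X j ∉ C.ideal := fun h =>
    (C.isPrime.mem_or_mem h).elim hFI fun h => hj ((toCone_eq_zero_iff C).2 h)
  rw [← IsPrime.vanishingIdeal_zeroLocus (K := k) C.ideal, mem_vanishingIdeal_iff] at hG
  push Not at hG
  obtain ⟨x, hx, hxG⟩ := hG
  rw [map_mul, aeval_X] at hxG
  have hx0 : x ≠ 0 := by
    rintro rfl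
    simp at hxG
  obtain ⟨t, ht⟩ := Projectivization.exists_smul_eq_mk_rep k x hx0
  have hev : ∀ (e : ℕ) (H : MvPolynomial (Fin (n + 1)) k), H.IsHomogeneous e →
      eval (Projectivization.mk k x hx0).rep H = (t : k) ^ e * eval x H := by
    intro e H hH
    rw [← IsHomogeneous.eval_mul_left hH, ← ht]
    rfl
  refine ⟨Projectivization.mk k x hx0, fun e H hH hHI => ?_, ?_⟩
  · have := hx H hHI
    rw [aeval_self_eq_eval] at this
    rw [hev e H hH, this, mul_zero]
  · rw [hev d F hF]
    rw [aeval_self_eq_eval] at hxG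
    exact mul_ne_zero (pow_ne_zero _ t.ne_zero) (left_ne_zero_of_mul hxG)

/-- A homogeneous polynomial that vanishes at all but finitely many points of the curve belongs to
the ideal of the curve. -/
theorem mem_ideal_of_eval_eq_zero [IsAlgClosed k] {S : Set (PSpace k n)} (hS : S.Finite)
    {F : MvPolynomial (Fin (n + 1)) k} {d : ℕ} (hF : F.IsHomogeneous d)
    (h : ∀ P ∈ C.points, P ∉ S → eval P.rep F = 0) : F ∈ C.ideal := by
  by_contra hFI
  -- Multiplying `F` by one such linear form for each point of `S` gives a form outside the prime
  -- ideal that vanishes on `S`.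
  choose v hv0 hvI using exists_linForm_notMem C
  obtain ⟨P, hP, hne⟩ := exists_point_eval_ne_zero C
    (hF.mul (IsHomogeneous.prod hS.toFinset (fun Q => ProjCurve.linForm (v Q)) (fun _ => 1)
      fun Q _ => isHomogeneous_linForm _)) (by
    intro hm
    rcases C.isPrime.mem_or_mem hm with hm | hm
    · exact hFI hm
    · obtain ⟨Q, -, hQ⟩ := (Ideal.IsPrime.prod_mem_iff).1 hm
      exact hvI Q hQ)
  rw [map_mul] at hne
  refine left_ne_zero_of_mul hne (h P hP fun hPS => right_ne_zero_of_mul hne ?_)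
  rw [map_prod]
  exact Finset.prod_eq_zero (hS.mem_toFinset.2 hPS) (hv0 P)

/-- Finitely many rational functions have homogeneous numerators and a common denominator. -/
theorem exists_common_denominator {m : ℕ} (z : Fin m → C.K) :
    ∃ (d : ℕ) (a : Fin m → MvPolynomial (Fin (n + 1)) k) (b : MvPolynomial (Fin (n + 1)) k),
      (∀ i, (a i).IsHomogeneous d) ∧ b.IsHomogeneous d ∧ b ∉ C.ideal ∧
      ∀ i, (z i : ConeField C.ideal) * toCone C.ideal b = toCone C.ideal (a i) := by
  have single : ∀ f : C.K, ∃ (d : ℕ) (a b : MvPolynomial (Fin (n + 1)) k),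
      a.IsHomogeneous d ∧ b.IsHomogeneous d ∧ toCone C.ideal b ≠ 0 ∧
      (f : ConeField C.ideal) * toCone C.ideal b = toCone C.ideal a := by
    rintro ⟨f, hf⟩
    simp only
    induction hf using IntermediateField.adjoin_induction with
    | mem x hx =>
      obtain ⟨i, j, rfl⟩ := hx
      -- If `X j` vanishes on the curve, the quotient is the default value `0`, represented as `0 /
      -- 1`.
      by_cases hj : toCone C.ideal (X j) = 0
      · exact ⟨0, 0, 1, isHomogeneous_zero _ _ _, isHomogeneous_one _ _, by simp, by simp [hj]⟩
      · exact ⟨1, X i, X j, isHomogeneous_X _ _, isHomogeneous_X _ _, hj, div_mul_cancel₀ _ hj⟩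
    | algebraMap c =>
      refine ⟨0, MvPolynomial.C c, 1, isHomogeneous_C _ _, isHomogeneous_one _ _, by simp, ?_⟩
      rw [map_one, mul_one]
      exact ((toCone C.ideal).commutes c).symm
    | add x y hx hy hx' hy' =>
      obtain ⟨d, a, b, ha, hb, h0, h⟩ := hx'
      obtain ⟨d', a', b', ha', hb', h0', h'⟩ := hy'
      refine ⟨d + d', a * b' + b * a', b * b', (ha.mul hb').add (hb.mul ha'), hb.mul hb', ?_, ?_⟩
      · rw [map_mul]; exact mul_ne_zero h0 h0'
      · rw [map_add, map_mul, map_mul, map_mul, ← h, ← h']; ring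
    | mul x y hx hy hx' hy' =>
      obtain ⟨d, a, b, ha, hb, h0, h⟩ := hx'
      obtain ⟨d', a', b', ha', hb', h0', h'⟩ := hy'
      refine ⟨d + d', a * a', b * b', ha.mul ha', hb.mul hb', ?_, ?_⟩
      · rw [map_mul]; exact mul_ne_zero h0 h0'
      · rw [map_mul, map_mul, ← h, ← h']; ring
    | inv x hx hx' =>
      obtain ⟨d, a, b, ha, hb, h0, h⟩ := hx'
      by_cases hx0 : x = 0
      · exact ⟨0, 0, 1, isHomogeneous_zero _ _ _, isHomogeneous_one _ _, by simp, by simp [hx0]⟩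
      · refine ⟨d, b, a, hb, ha, ?_, ?_⟩
        · rw [← h]; exact mul_ne_zero hx0 h0
        · rw [← h]; field_simp
  induction m with
  | zero => exact ⟨0, fun i => i.elim0, 1, fun i => i.elim0, isHomogeneous_one _ _,
      fun h => C.isPrime.ne_top ((Ideal.eq_top_iff_one _).2 h), fun i => i.elim0⟩
  | succ m ih =>
    obtain ⟨d, a, b, ha, hb, hbI, h⟩ := ih (fun i => z i.succ)
    obtain ⟨d', a', b', ha', hb', h0', h'⟩ := single (z 0)
    refine ⟨d + d', Fin.cons (b * a') (fun i => a i * b'), b * b', ?_, hb.mul hb', ?_, ?_⟩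
    · refine Fin.cases (hb.mul ha') fun i => ?_
      exact (ha i).mul hb'
    · intro hm
      rcases C.isPrime.mem_or_mem hm with hm | hm
      · exact hbI hm
      · exact h0' ((toCone_eq_zero_iff C).2 hm)
    · refine Fin.cases ?_ fun i => ?_
      · rw [Fin.cons_zero, map_mul, map_mul, ← h']; ring
      · rw [Fin.cons_succ, map_mul, map_mul, ← h i]; ring

end ToCone

/-! ### Congruences modulo powers of an ideal -/

theorem linForm_sub {k : Type*} [Field k] {n : ℕ} (v w : Fin (n + 1) → k) :
    ProjCurve.linForm (v - w) = ProjCurve.linForm v - ProjCurve.linForm w := by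
  simp [ProjCurve.linForm, sub_mul, Finset.sum_sub_distrib]

theorem linForm_smul {k : Type*} [Field k] {n : ℕ} (c : k) (v : Fin (n + 1) → k) :
    ProjCurve.linForm (c • v) = MvPolynomial.C c * ProjCurve.linForm v := by
  simp [ProjCurve.linForm, Finset.mul_sum, mul_assoc]

theorem not_maximalIdeal_le_sq (R : Type*) [CommRing R] [IsDomain R]
    [IsDiscreteValuationRing R] :
    ¬ IsLocalRing.maximalIdeal R ≤ IsLocalRing.maximalIdeal R ^ 2 := by
  intro h
  have h3 := (natCast_le_length_quotient_iff (IsLocalRing.maximalIdeal R ^ 1) 2).2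
    (by simpa using h)
  rw [IsDiscreteValuationRing.length_quotient_pow_maximalIdeal] at h3
  norm_num at h3

/-- Frobenius is additive, so `f ^ q - c ^ q = (f - c) ^ q` lies in `M ^ q`. Freezing the
coefficients `f l` of the relation at their residues `c l` therefore costs only an element of `M ^
q`. -/
theorem sum_pow_smul_mem_pow {k R ι : Type*} [Field k] [CommRing R] [Algebra k R] [Fintype ι]
    {p : ℕ} [Fact p.Prime] [CharP R p] (r : ℕ) {M : Ideal R} {f y : ι → R} {c : ι → k}
    (hf : ∀ l, f l - algebraMap k R (c l) ∈ M) (h : ∑ l, f l ^ p ^ r * y l = 0) :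
    ∑ l, c l ^ p ^ r • y l ∈ M ^ p ^ r := by
  have key : ∑ l, c l ^ p ^ r • y l = -∑ l, (f l - algebraMap k R (c l)) ^ p ^ r * y l := by
    simp only [sub_pow_char_pow, sub_mul, Finset.sum_sub_distrib, h, zero_sub, neg_neg,
      Algebra.smul_def, map_pow]
  rw [key, neg_mem_iff]
  exact Ideal.sum_mem _ fun l _ => Ideal.mul_mem_right _ _ (Ideal.pow_mem_pow (hf l) _)

theorem mem_of_mul_isUnit_of_sub_mem {k R : Type*} [Field k] [CommRing R] [Algebra k R]
    {J : Ideal R} {f g h : R} {c : k} (he : f * g = h) (hg : IsUnit g) (hc : c = 0)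
    (hm : h - algebraMap k R c ∈ J) : f ∈ J := by
  rw [hc, map_zero, sub_zero, ← he] at hm
  exact (Ideal.mul_unit_mem_iff_mem _ hg).1 hm

/-- Modulo `J`, both `φ` and evaluation at `c` are algebra maps, and they agree on the variables. -/
theorem sub_algebraMap_eval_mem {k R σ : Type*} [Field k] [CommRing R] [Algebra k R]
    (φ : MvPolynomial σ k →ₐ[k] R) {J : Ideal R} {c : σ → k}
    (h : ∀ i, φ (X i) - algebraMap k R (c i) ∈ J) (F : MvPolynomial σ k) :
    φ F - algebraMap k R (eval c F) ∈ J := by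
  have h2 : (Ideal.Quotient.mkₐ k J).comp φ =
      ((Ideal.Quotient.mkₐ k J).comp (Algebra.ofId k R)).comp (aeval c) := by
    apply MvPolynomial.algHom_ext
    intro i
    simp only [AlgHom.comp_apply, aeval_X, Ideal.Quotient.mkₐ_eq_mk]
    exact Ideal.Quotient.eq.2 (h i)
  have h3 := DFunLike.congr_fun h2 F
  rw [← aeval_self_eq_eval]
  exact Ideal.Quotient.eq.1 h3

/-! ### Values of rational functions and the residue map of the local ring -/

namespace ProjCurve

variable {k : Type*} [Field k] {n : ℕ} {C : ProjCurve k n} {P : PSpace k n}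

theorem HasValueAt.unique (hP : P ∈ C.points) {f : C.K} {c c' : k} (h : C.HasValueAt P f c)
    (h' : C.HasValueAt P f c') : c = c' := by
  obtain ⟨d, a, b, ha, hb, hbP, hf, rfl⟩ := h
  obtain ⟨e, a', b', ha', hb', hbP', hf', rfl⟩ := h'
  have hm : a * b' - b * a' ∈ C.ideal := by
    rw [← toCone_eq_zero_iff, map_sub, map_mul, map_mul, ← hf, ← hf']
    ring
  have h0 := hP _ _ ((ha.mul hb').sub (hb.mul ha')) hm
  rw [map_sub, map_mul, map_mul, sub_eq_zero] at h0
  rw [div_eq_div_iff hbP hbP', h0, mul_comm]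

theorem HasValueAt.add {f g : C.K} {c c' : k} (h : C.HasValueAt P f c)
    (h' : C.HasValueAt P g c') : C.HasValueAt P (f + g) (c + c') := by
  obtain ⟨d, a, b, ha, hb, hbP, hf, rfl⟩ := h
  obtain ⟨e, a', b', ha', hb', hbP', hf', rfl⟩ := h'
  refine ⟨d + e, a * b' + b * a', b * b', (ha.mul hb').add (hb.mul ha'), hb.mul hb', ?_, ?_, ?_⟩
  · rw [map_mul]
    exact mul_ne_zero hbP hbP'
  · rw [map_add, map_mul, map_mul, map_mul, ← hf, ← hf']
    push_cast
    ring
  · rw [map_add, map_mul, map_mul, map_mul, div_add_div _ _ hbP hbP']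

theorem HasValueAt.mul {f g : C.K} {c c' : k} (h : C.HasValueAt P f c)
    (h' : C.HasValueAt P g c') : C.HasValueAt P (f * g) (c * c') := by
  obtain ⟨d, a, b, ha, hb, hbP, hf, rfl⟩ := h
  obtain ⟨e, a', b', ha', hb', hbP', hf', rfl⟩ := h'
  refine ⟨d + e, a * a', b * b', ha.mul ha', hb.mul hb', ?_, ?_, ?_⟩
  · rw [map_mul]
    exact mul_ne_zero hbP hbP'
  · rw [map_mul, map_mul, ← hf, ← hf']
    push_cast
    ring
  · rw [map_mul, map_mul, div_mul_div_comm]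

theorem hasValueAt_algebraMap (c : k) : C.HasValueAt P (algebraMap k C.K c) c := by
  refine ⟨0, MvPolynomial.C c, 1, isHomogeneous_C _ _, isHomogeneous_one _ _, ?_, ?_, ?_⟩
  · simp
  · rw [map_one, mul_one]
    exact ((toCone C.ideal).commutes c).symm
  · simp

/-- The evaluation at `P` of the rational functions that are regular at `P`. -/
def residue (hP : P ∈ C.points) : C.localRing P →ₐ[k] k where
  toFun f := f.2.choose
  map_one' := (Subtype.prop (1 : C.localRing P)).choose_spec.unique hP
    (by simpa using hasValueAt_algebraMap (C := C) (P := P) 1)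
  map_mul' f g := (f * g).2.choose_spec.unique hP (f.2.choose_spec.mul g.2.choose_spec)
  map_zero' := (Subtype.prop (0 : C.localRing P)).choose_spec.unique hP
    (by simpa using hasValueAt_algebraMap (C := C) (P := P) 0)
  map_add' f g := (f + g).2.choose_spec.unique hP (f.2.choose_spec.add g.2.choose_spec)
  commutes' c := (Subtype.prop (algebraMap k (C.localRing P) c)).choose_spec.unique hP
    (hasValueAt_algebraMap c)

theorem hasValueAt_residue (hP : P ∈ C.points) (f : C.localRing P) :
    C.HasValueAt P f (residue hP f) :=
  f.2.choose_spec

theorem residue_eq (hP : P ∈ C.points) {f : C.localRing P} {c : k}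
    (h : C.HasValueAt P f c) : residue hP f = c :=
  (hasValueAt_residue hP f).unique hP h

theorem isUnit_of_residue_ne_zero (hP : P ∈ C.points) {f : C.localRing P}
    (h : residue hP f ≠ 0) : IsUnit f := by
  obtain ⟨d, a, b, ha, hb, hbP, hf, hc⟩ := hasValueAt_residue hP f
  have haP : eval P.rep a ≠ 0 := fun h0 => h (by rw [hc, h0, zero_div])
  have hf0 : (f : C.K) ≠ 0 := fun h0 => h (by
    have : f = 0 := Subtype.ext h0
    rw [this, map_zero])
  have hf0' : ((f : C.K) : ConeField C.ideal) ≠ 0 := fun h0 => hf0 (Subtype.ext h0)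
  refine IsUnit.of_mul_eq_one (⟨(f : C.K)⁻¹, _, d, b, a, hb, ha, haP, ?_, rfl⟩ : C.localRing P) ?_
  · rw [← hf]
    push_cast
    field_simp
  · exact Subtype.ext (mul_inv_cancel₀ hf0)

theorem mem_maximalIdeal_iff (hP : P ∈ C.points) [IsLocalRing (C.localRing P)]
    {f : C.localRing P} :
    f ∈ IsLocalRing.maximalIdeal (C.localRing P) ↔ residue hP f = 0 := by
  rw [IsLocalRing.mem_maximalIdeal, mem_nonunits_iff]
  constructor
  · intro h
    by_contra h0
    exact h (isUnit_of_residue_ne_zero hP h0)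
  · intro h hu
    exact (hu.map (residue hP)).ne_zero h

theorem sub_residue_mem (hP : P ∈ C.points) [IsLocalRing (C.localRing P)] (f : C.localRing P) :
    f - algebraMap k _ (residue hP f) ∈ IsLocalRing.maximalIdeal (C.localRing P) := by
  rw [mem_maximalIdeal_iff hP, map_sub, AlgHom.commutes]
  exact sub_self _

theorem toCone_ne_zero_of_eval_ne_zero (hP : P ∈ C.points) {F : MvPolynomial (Fin (n + 1)) k}
    {d : ℕ} (hF : F.IsHomogeneous d) (h : eval P.rep F ≠ 0) : toCone C.ideal F ≠ 0 :=
  fun h0 => h (hP d F hF ((toCone_eq_zero_iff C).1 h0))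

/-! ### Affine charts and contact orders of hyperplanes -/

section Chart

variable (hP : P ∈ C.points) {j : Fin (n + 1)} (hj : P.rep j ≠ 0)

theorem toCone_X_ne_zero (hP : P ∈ C.points) {j : Fin (n + 1)} (hj : P.rep j ≠ 0) :
    toCone C.ideal (X j) ≠ 0 :=
  toCone_ne_zero_of_eval_ne_zero hP (isHomogeneous_X _ _) (by simpa using hj)

theorem hasValueAt_ratio (hP : P ∈ C.points) {j : Fin (n + 1)} (hj : P.rep j ≠ 0)
    (i : Fin (n + 1)) :
    C.HasValueAt P (C.ratio i j) (P.rep i / P.rep j) :=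
  ⟨1, X i, X j, isHomogeneous_X _ _, isHomogeneous_X _ _, by simpa using hj,
    div_mul_cancel₀ _ (toCone_X_ne_zero hP hj), by simp⟩

/-- Dehomogenization with respect to `X j`, with values in the local ring at a point outside the
hyperplane `X j = 0`. -/
def germ : MvPolynomial (Fin (n + 1)) k →ₐ[k] C.localRing P :=
  aeval fun i => ⟨C.ratio i j, _, hasValueAt_ratio hP hj i⟩

theorem toCone_eq_pow_mul_germ {F : MvPolynomial (Fin (n + 1)) k} {d : ℕ}
    (hF : F.IsHomogeneous d) :
    toCone C.ideal F = toCone C.ideal (X j) ^ d * ((germ hP hj F : C.localRing P) : C.K) := by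
  rw [toCone_eq_pow_mul_aeval_ratio C hF (toCone_X_ne_zero hP hj)]
  congr 2
  change _ = (C.localRing P).val _
  rw [germ, MvPolynomial.comp_aeval_apply]
  rfl

theorem germ_eq_zero_iff {F : MvPolynomial (Fin (n + 1)) k} {d : ℕ} (hF : F.IsHomogeneous d) :
    germ hP hj F = 0 ↔ F ∈ C.ideal := by
  rw [← toCone_eq_zero_iff, toCone_eq_pow_mul_germ hP hj hF,
    mul_eq_zero_iff_left (pow_ne_zero _ (toCone_X_ne_zero hP hj))]
  simp

theorem residue_germ (F : MvPolynomial (Fin (n + 1)) k) :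
    residue hP (germ hP hj F) = eval (fun i => P.rep i / P.rep j) F := by
  rw [germ, MvPolynomial.comp_aeval_apply, ← aeval_self_eq_eval]
  congr 2
  funext i
  exact residue_eq hP (hasValueAt_ratio hP hj i)

theorem residue_germ_of_isHomogeneous {F : MvPolynomial (Fin (n + 1)) k} {d : ℕ}
    (hF : F.IsHomogeneous d) :
    residue hP (germ hP hj F) = (P.rep j)⁻¹ ^ d * eval P.rep F := by
  rw [residue_germ, ← IsHomogeneous.eval_mul_left hF]
  simp only [div_eq_inv_mul]

theorem isUnit_germ {F : MvPolynomial (Fin (n + 1)) k} {d : ℕ} (hF : F.IsHomogeneous d)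
    (h : eval P.rep F ≠ 0) : IsUnit (germ hP hj F) := by
  apply isUnit_of_residue_ne_zero hP
  rw [residue_germ_of_isHomogeneous hP hj hF]
  exact mul_ne_zero (pow_ne_zero _ (inv_ne_zero hj)) h

theorem mul_germ_eq_germ {f : C.localRing P} {a b : MvPolynomial (Fin (n + 1)) k} {d : ℕ}
    (ha : a.IsHomogeneous d) (hb : b.IsHomogeneous d)
    (h : ((f : C.K) : ConeField C.ideal) * toCone C.ideal b = toCone C.ideal a) :
    f * germ hP hj b = germ hP hj a := by
  rw [toCone_eq_pow_mul_germ hP hj ha, toCone_eq_pow_mul_germ hP hj hb, mul_left_comm] at h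
  exact Subtype.ext (Subtype.ext (mul_left_cancel₀ (pow_ne_zero d (toCone_X_ne_zero hP hj)) h))

theorem germ_X_self : germ hP hj (X j) = 1 := by
  rw [germ, aeval_X]
  exact Subtype.ext (Subtype.ext (div_self (toCone_X_ne_zero hP hj)))

theorem germ_linForm (v : Fin (n + 1) → k) :
    germ hP hj (linForm v) = ∑ i, v i • germ hP hj (X i) := by
  simp [linForm, Algebra.smul_def]

theorem hyperplaneIdeal_eq_span (hP : P ∈ C.points) {j : Fin (n + 1)} (hj : P.rep j ≠ 0)
    (H : PSpace k n) :
    C.hyperplaneIdeal P H = Ideal.span {germ hP hj (linForm H.rep)} := by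
  have hX := toCone_X_ne_zero hP hj
  apply le_antisymm
  · rw [hyperplaneIdeal, Ideal.span_le]
    rintro f ⟨m, hm, hf⟩
    rw [SetLike.mem_coe, Ideal.mem_span_singleton]
    have hu := isUnit_germ hP hj (isHomogeneous_linForm m) (by rwa [eval_linForm])
    have he := mul_germ_eq_germ hP hj (isHomogeneous_linForm H.rep) (isHomogeneous_linForm m) hf
    rw [← he]
    exact hu.dvd_mul_right.1 dvd_rfl
  · rw [Ideal.span_singleton_le_iff_mem]
    refine Ideal.subset_span ⟨Pi.single j 1, by simpa [Pi.single_apply] using hj, ?_⟩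
    rw [linForm_single, toCone_eq_pow_mul_germ hP hj (isHomogeneous_linForm H.rep), pow_one,
      mul_comm]

theorem natCast_le_interMult_iff [IsDiscreteValuationRing (C.localRing P)] (H : PSpace k n)
    (s : ℕ) : (s : ℕ∞) ≤ C.interMult P H ↔
      germ hP hj (linForm H.rep) ∈ IsLocalRing.maximalIdeal (C.localRing P) ^ s := by
  rw [interMult, quotLength, natCast_le_length_quotient_iff, hyperplaneIdeal_eq_span hP hj,
    Ideal.span_singleton_le_iff_mem]

theorem eval_linForm_eq_zero_of_germ_mem [IsLocalRing (C.localRing P)] {v : Fin (n + 1) → k}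
    (h : germ hP hj (linForm v) ∈ IsLocalRing.maximalIdeal (C.localRing P)) :
    eval P.rep (linForm v) = 0 := by
  rw [mem_maximalIdeal_iff hP, residue_germ_of_isHomogeneous hP hj (isHomogeneous_linForm v)] at h
  exact (mul_eq_zero.1 h).resolve_left (pow_ne_zero _ (inv_ne_zero hj))

/-- If `∑ c_l ^ q X_l` vanishes on the curve, then the hyperplane with coordinates `c_l(P) ^ q`
meets the curve at `P` with multiplicity at least `q`. -/
theorem germ_linForm_mem_pow [IsLocalRing (C.localRing P)] {p : ℕ} [Fact p.Prime] [CharP k p]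
    (r : ℕ) {c : Fin (n + 1) → MvPolynomial (Fin (n + 1)) k} {d : ℕ}
    (hc : ∀ l, (c l).IsHomogeneous d) (h : ∑ l, c l ^ p ^ r * X l ∈ C.ideal) :
    germ hP hj (linForm fun l => eval P.rep (c l) ^ p ^ r) ∈
      IsLocalRing.maximalIdeal (C.localRing P) ^ p ^ r := by
  have : CharP (C.localRing P) p :=
    charP_of_injective_algebraMap (algebraMap k (C.localRing P)).injective p
  have h0 : germ hP hj (∑ l, c l ^ p ^ r * X l) = 0 := by
    rw [germ_eq_zero_iff hP hj (d := d * p ^ r + 1)]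
    · exact h
    · exact IsHomogeneous.sum _ _ _ fun l _ => ((hc l).pow _).mul (isHomogeneous_X _ _)
  simp only [map_sum, map_mul, map_pow] at h0
  have h1 := sum_pow_smul_mem_pow r (fun l => sub_residue_mem hP (germ hP hj (c l))) h0
  rw [← germ_linForm] at h1
  -- Residues in the chart differ from values at `P.rep` by a power of `P.rep j`, common to all `l`
  -- because the `c l` have the same degree.
  have h2 : linForm (fun l => eval P.rep (c l) ^ p ^ r) =
      MvPolynomial.C ((((P.rep j)⁻¹ ^ d) ^ p ^ r)⁻¹) *
        linForm (fun l => residue hP (germ hP hj (c l)) ^ p ^ r) := by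
    rw [linForm, linForm, Finset.mul_sum]
    refine Finset.sum_congr rfl fun l _ => ?_
    rw [residue_germ_of_isHomogeneous hP hj (hc l), ← mul_assoc, ← map_mul, mul_pow,
      inv_mul_cancel_left₀ (pow_ne_zero _ (pow_ne_zero _ (inv_ne_zero hj)))]
  rw [h2, map_mul]
  exact Ideal.mul_mem_left _ _ h1

/-- At a nonsingular point, some linear form vanishes to order exactly one. -/
theorem exists_linForm_germ_notMem_sq [IsDiscreteValuationRing (C.localRing P)] :
    ∃ v, eval P.rep (linForm v) = 0 ∧
      germ hP hj (linForm v) ∉ IsLocalRing.maximalIdeal (C.localRing P) ^ 2 := by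
  by_contra! h
  set M := IsLocalRing.maximalIdeal (C.localRing P)
  -- Otherwise the affine coordinates are constant modulo `M ^ 2`. Then so is every regular
  -- function, which forces `M ≤ M ^ 2`.
  have hchart : ∀ i, germ hP hj (X i) - algebraMap k _ (P.rep i / P.rep j) ∈ M ^ 2 := by
    intro i
    have h1 := h (Pi.single i 1 - (P.rep i / P.rep j) • Pi.single j 1) (by
      simp [eval_linForm, sub_mul, Finset.sum_sub_distrib, Pi.single_apply, hj])
    have h2 : linForm (Pi.single i 1 - (P.rep i / P.rep j) • Pi.single j 1) =
        X i - MvPolynomial.C (P.rep i / P.rep j) * X j := by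
        rw [linForm_sub, linForm_smul, linForm_single, linForm_single]
    rw [h2, map_sub, map_mul, germ_X_self, mul_one] at h1
    rwa [← AlgHom.commutes (germ hP hj)]
  have hgerm : ∀ F, germ hP hj F - algebraMap k _ (residue hP (germ hP hj F)) ∈ M ^ 2 := by
    intro F
    rw [residue_germ]
    exact sub_algebraMap_eval_mem _ hchart F
  have hle : M ≤ M ^ 2 := by
    intro f hf
    obtain ⟨d, a, b, ha, hb, hbP, hf', hc⟩ := hasValueAt_residue hP f
    rw [(mem_maximalIdeal_iff hP).1 hf] at hc
    have haP : eval P.rep a = 0 := by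
      rcases div_eq_zero_iff.1 hc.symm with h | h
      · exact h
      · exact absurd h hbP
    have h0 : residue hP (germ hP hj a) = 0 := by
      rw [residue_germ_of_isHomogeneous hP hj ha, haP, mul_zero]
    exact mem_of_mul_isUnit_of_sub_mem (mul_germ_eq_germ hP hj ha hb hf')
      (isUnit_germ hP hj hb hbP) h0 (hgerm a)
  exact not_maximalIdeal_le_sq _ hle

end Chart

end ProjCurve

/-! ### Algebra behind the contact argument: orders, eigenvalues, `q`-th powers -/

/-- Terms of distinct exact orders cannot cancel: the first nonzero coefficient would determine the
order of the sum. -/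
theorem eq_zero_of_sum_smul_mem_pow {k R : Type*} [Field k] [CommRing R] [Algebra k R] {m : ℕ}
    {M : Ideal R} {ε : Fin m → ℕ} (hε : StrictMono ε) {g : Fin m → R}
    (hg : ∀ i, g i ∈ M ^ ε i) (hg' : ∀ i, g i ∉ M ^ (ε i + 1)) {c : Fin m → k} {e : ℕ}
    (h : ∑ i, c i • g i ∈ M ^ e) (i : Fin m) (hi : ε i < e) : c i = 0 := by
  induction i using WellFoundedLT.induction with
  | ind i ih =>
    by_contra hc
    have h1 : c i • g i ∈ M ^ (ε i + 1) := by
      rw [← Finset.add_sum_erase _ _ (Finset.mem_univ i)] at h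
      refine (Ideal.add_mem_iff_left _ ?_).1 (Ideal.pow_le_pow_right hi h)
      refine Ideal.sum_mem _ fun l hl => ?_
      rcases lt_trichotomy l i with hli | rfl | hli
      · rw [ih l hli ((hε hli).trans hi), zero_smul]
        exact Ideal.zero_mem _
      · simp at hl
      · rw [Algebra.smul_def]
        exact Ideal.mul_mem_left _ _ (Ideal.pow_le_pow_right (hε hli) (hg l))
    refine hg' i ?_
    have h2 : g i = algebraMap k R (c i)⁻¹ * c i • g i := by
      rw [Algebra.smul_def, ← mul_assoc, ← map_mul, inv_mul_cancel₀ hc, map_one, one_mul]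
    rw [h2]
    exact Ideal.mul_mem_left _ _ h1

/-- The eigenvalue is a root of the characteristic polynomial of `B`, so it is algebraic over the
algebraically closed field `k`. -/
theorem exists_algebraMap_eq_of_mulVec_eq_smul {k E ι : Type*} [Field k] [IsAlgClosed k] [Field E]
    [Algebra k E] [Fintype ι] [DecidableEq ι] (B : Matrix ι ι k) {u : ι → E} (hu : u ≠ 0) {t : E}
    (h : (B.map (algebraMap k E)).mulVec u = t • u) : ∃ μ : k, algebraMap k E μ = t := by
  have hdet : (Matrix.scalar ι t - B.map (algebraMap k E)).det = 0 := by
    refine Matrix.exists_mulVec_eq_zero_iff.1 ⟨u, hu, ?_⟩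
    rw [Matrix.sub_mulVec, h]
    ext i
    simp
  rw [← Matrix.eval_charpoly, Matrix.charpoly_map, Polynomial.eval_map_algebraMap] at hdet
  have hint : IsIntegral k t := ⟨B.charpoly, B.charpoly_monic, hdet⟩
  exact hint.mem_range_algebraMap_of_minpoly_splits (IsAlgClosed.splits _)

/-- The ratio `L i / L j` equals `(a i / a j) ^ q` and is regular, and a discrete valuation ring is
factorial, so `a i / a j` is itself regular. Subtracting its residue before taking the `q`-th power
gives an element of `M ^ q`. -/
theorem exists_sub_smul_mem_pow {k R ι : Type*} [Field k] [CommRing R] [IsDomain R]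
    [IsDiscreteValuationRing R] [Algebra k R] {p : ℕ} [Fact p.Prime] [CharP R p] (r : ℕ)
    (hres : ∀ f : R, ∃ c : k, f - algebraMap k R c ∈ IsLocalRing.maximalIdeal R)
    {a L : ι → R} (h : ∀ i l, L i * a l ^ p ^ r = L l * a i ^ p ^ r) {i₀ : ι} (ha : a i₀ ≠ 0)
    {j : ι} (hj : IsUnit (L j)) (i : ι) :
    ∃ c : k, L i - c • L j ∈ IsLocalRing.maximalIdeal R ^ p ^ r := by
  have hq : p ^ r ≠ 0 := pow_ne_zero _ (Fact.out : p.Prime).ne_zero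
  have haj : a j ≠ 0 := by
    intro h0
    have h1 := h i₀ j
    rw [h0, zero_pow hq, mul_zero] at h1
    exact mul_ne_zero hj.ne_zero (pow_ne_zero _ ha) h1.symm
  have hdvd : a j ^ p ^ r ∣ a i ^ p ^ r :=
    hj.dvd_mul_left.1 ⟨L i, by rw [← h i j, mul_comm]⟩
  obtain ⟨e, he⟩ := (UniqueFactorizationMonoid.pow_dvd_pow_iff_dvd hq).1 hdvd
  have hL : L i = L j * e ^ p ^ r := by
    have h1 := h i j
    rw [he, mul_pow] at h1
    refine mul_right_cancel₀ (pow_ne_zero (p ^ r) haj) ?_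
    rw [h1]
    ring
  obtain ⟨c, hc⟩ := hres e
  refine ⟨c ^ p ^ r, ?_⟩
  have h2 : L i - c ^ p ^ r • L j = L j * (e - algebraMap k R c) ^ p ^ r := by
    rw [sub_pow_char_pow, hL, Algebra.smul_def, map_pow]
    ring
  rw [h2]
  exact Ideal.mul_mem_left _ _ (Ideal.pow_mem_pow hc _)

/-! ### Uniqueness of the osculating hyperplane; forms representing the Gauss map -/

namespace ProjCurve

variable {k : Type*} [Field k] {n : ℕ} {C : ProjCurve k n} {P : PSpace k n}

theorem exists_rep_ne_zero (P : PSpace k n) : ∃ j, P.rep j ≠ 0 := by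
  by_contra! h0
  exact P.rep_nonzero (funext h0)

theorem linForm_sum {ι : Type*} (s : Finset ι) (v : ι → Fin (n + 1) → k) :
    linForm (∑ i ∈ s, v i) = ∑ i ∈ s, linForm (v i) := by
  simp only [linForm, Finset.sum_apply, map_sum, Finset.sum_mul]
  exact Finset.sum_comm

theorem germ_linForm_sum_smul (hP : P ∈ C.points) {j : Fin (n + 1)} (hj : P.rep j ≠ 0)
    {ι : Type*} [Fintype ι] (c : ι → k) (v : ι → Fin (n + 1) → k) :
    germ hP hj (linForm (∑ i, c i • v i)) = ∑ i, c i • germ hP hj (linForm (v i)) := by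
  rw [linForm_sum, map_sum]
  refine Finset.sum_congr rfl fun i _ => ?_
  rw [linForm_smul, map_mul, Algebra.smul_def]
  congr 1
  exact (germ hP hj).commutes (c i)

/-- At a generic point, two hyperplanes of maximal contact coincide. -/
theorem mul_eq_mul_of_germ_mem_pow {ε : Fin (n + 1) → ℕ} (hε : StrictMono ε)
    (hPε : C.orders P = Set.range ε) (hP : P ∈ C.points) [IsDiscreteValuationRing (C.localRing P)]
    {j : Fin (n + 1)} (hj : P.rep j ≠ 0) {v w : Fin (n + 1) → k}
    (hv : germ hP hj (linForm v) ∈ IsLocalRing.maximalIdeal (C.localRing P) ^ ε (Fin.last n))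
    (hw : germ hP hj (linForm w) ∈ IsLocalRing.maximalIdeal (C.localRing P) ^ ε (Fin.last n))
    (i l : Fin (n + 1)) : v i * w l = v l * w i := by
  have hH : ∀ i, ∃ H : PSpace k n, C.interMult P H = ε i := fun i => by
    have : ε i ∈ C.orders P := hPε ▸ ⟨i, rfl⟩
    exact this
  choose H hH using hH
  have hg : ∀ i, germ hP hj (linForm (H i).rep) ∈
      IsLocalRing.maximalIdeal (C.localRing P) ^ ε i := fun i =>
    (natCast_le_interMult_iff hP hj (H i) (ε i)).1 (hH i).ge
  have hg' : ∀ i, germ hP hj (linForm (H i).rep) ∉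
      IsLocalRing.maximalIdeal (C.localRing P) ^ (ε i + 1) := fun i hm => by
    have h1 := (natCast_le_interMult_iff hP hj (H i) (ε i + 1)).2 hm
    rw [hH i] at h1
    exact absurd (by exact_mod_cast h1) (Nat.not_succ_le_self (ε i))
  have key : ∀ (e : ℕ) (c : Fin (n + 1) → k), germ hP hj (linForm (∑ i, c i • (H i).rep)) ∈
      IsLocalRing.maximalIdeal (C.localRing P) ^ e → ∀ i, ε i < e → c i = 0 := by
    intro e c h
    rw [germ_linForm_sum_smul] at h
    exact eq_zero_of_sum_smul_mem_pow hε hg hg' h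
  -- Hyperplanes realizing the `n + 1` distinct orders form a basis of the dual space; in this
  -- basis, contact `ε_n` leaves only the last coefficient.
  have hli : LinearIndependent k fun i => (H i).rep := by
    rw [Fintype.linearIndependent_iff]
    intro c hc i
    refine key (ε i + 1) c ?_ i (Nat.lt_succ_self _)
    have h0 : linForm (0 : Fin (n + 1) → k) = 0 := by simp [linForm]
    rw [hc, h0, map_zero]
    exact Ideal.zero_mem _
  have hsp := hli.span_eq_top_of_card_eq_finrank' (by simp)
  have hlast : ∀ v : Fin (n + 1) → k, germ hP hj (linForm v) ∈
      IsLocalRing.maximalIdeal (C.localRing P) ^ ε (Fin.last n) →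
      ∃ c : k, v = c • (H (Fin.last n)).rep := by
    intro v hv
    have hvs : v ∈ Submodule.span k (Set.range fun i => (H i).rep) := hsp ▸ Submodule.mem_top
    obtain ⟨c, rfl⟩ := (Submodule.mem_span_range_iff_exists_fun k).1 hvs
    refine ⟨c (Fin.last n), Finset.sum_eq_single _ (fun i _ hi => ?_) (by simp)⟩
    rw [key _ c hv i (hε (Fin.lt_last_iff_ne_last.2 hi)), zero_smul]
  obtain ⟨c, rfl⟩ := hlast v hv
  obtain ⟨c', rfl⟩ := hlast w hw
  simp only [Pi.smul_apply, smul_eq_mul]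
  ring

/-- The cross-multiplied form of proportionality also covers the points where every `a i` vanishes.
-/
theorem MapsPoint.mul_pow_eq (hP : P ∈ C.points) {z : Fin (n + 1) → C.K} {q : ℕ} {H : PSpace k n}
    (h : C.MapsPoint (fun i => z i ^ q) P H) {d : ℕ} {a : Fin (n + 1) → MvPolynomial (Fin (n + 1)) k}
    {b : MvPolynomial (Fin (n + 1)) k} (ha : ∀ i, (a i).IsHomogeneous d)
    (hz : ∀ i, (z i : ConeField C.ideal) * toCone C.ideal b = toCone C.ideal (a i))
    (i l : Fin (n + 1)) :
    H.rep i * eval P.rep (a l) ^ q = H.rep l * eval P.rep (a i) ^ q := by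
  obtain ⟨g, hg⟩ := h
  obtain ⟨e, α, β, hα, hβ, hβP, hf, hi⟩ := hg i
  obtain ⟨e', α', β', hα', hβ', hβP', hf', hl⟩ := hg l
  have hm : α * β' * a l ^ q - α' * β * a i ^ q ∈ C.ideal := by
    rw [← toCone_eq_zero_iff]
    simp only [map_sub, map_mul, map_pow, ← hf, ← hf', ← hz]
    push_cast
    ring
  have h0 := hP (e + e' + d * q) _ (((hα.mul hβ').mul ((ha l).pow q)).sub (by
    rw [add_comm e e']
    exact (hα'.mul hβ).mul ((ha i).pow q))) hm
  rw [hi, hl]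
  simp only [map_sub, map_mul, map_pow] at h0
  field_simp
  linear_combination h0

/-- A linear relation between the `z i` gives a linear relation between the coordinates of the
image points. -/
theorem MapsPoint.sum_pow_mul_eq_zero (hP : P ∈ C.points) {z : Fin (n + 1) → C.K} {p : ℕ}
    [Fact p.Prime] [CharP k p] {r : ℕ} {H : PSpace k n}
    (h : C.MapsPoint (fun i => z i ^ p ^ r) P H) {v : Fin (n + 1) → k}
    (hv : ∑ i, v i • z i = 0) : ∑ i, v i ^ p ^ r * H.rep i = 0 := by
  have : CharP C.K p := charP_of_injective_algebraMap (algebraMap k C.K).injective p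
  obtain ⟨g, hg⟩ := h
  have h1 : ∑ i, v i ^ p ^ r • (⟨g * z i ^ p ^ r, _, hg i⟩ : C.localRing P) = 0 := by
    apply Subtype.ext
    rw [AddSubmonoidClass.coe_finsetSum]
    have h2 : g * (∑ i, v i • z i) ^ p ^ r = 0 := by
      rw [hv, zero_pow (pow_ne_zero _ (Fact.out : p.Prime).ne_zero), mul_zero]
    rw [sum_pow_char_pow, Finset.mul_sum] at h2
    rw [← ZeroMemClass.coe_zero (C.localRing P)] at h2
    refine Eq.trans (Finset.sum_congr rfl fun i _ => ?_) h2
    change v i ^ p ^ r • (g * z i ^ p ^ r) = _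
    rw [smul_pow, mul_smul_comm]
  have h3 := congrArg (residue hP) h1
  rw [map_sum, map_zero] at h3
  rw [← h3]
  refine Finset.sum_congr rfl fun i _ => ?_
  rw [map_smul, smul_eq_mul, residue_eq hP (hg i)]

section Gauss

variable {p : ℕ} [Fact p.Prime] {ε : Fin (n + 1) → ℕ} {r : ℕ}
  {d : ℕ} {a : Fin (n + 1) → MvPolynomial (Fin (n + 1)) k}

theorem exists_isGaussImage (hP : P ∈ C.genericPoints ε) : ∃ H, C.IsGaussImage ε P H := by
  have : ε (Fin.last n) ∈ C.orders P := hP.2 ▸ ⟨_, rfl⟩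
  obtain ⟨H, hH⟩ := this
  exact ⟨H, hP, hH⟩

theorem onHyperplane_of_one_le_interMult (hP : C.IsNonsingularAt P) {H : PSpace k n}
    (h : 1 ≤ C.interMult P H) : OnHyperplane P H := by
  obtain ⟨hP, hD⟩ := hP
  obtain ⟨j, hj⟩ := exists_rep_ne_zero P
  have h1 := (natCast_le_interMult_iff hP hj H 1).1 (by exact_mod_cast h)
  rw [pow_one] at h1
  rw [OnHyperplane, ← eval_linForm]
  exact eval_linForm_eq_zero_of_germ_mem hP hj h1

/-- The Gauss map associates with a point of the curve a hyperplane through that point. -/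
theorem sum_pow_mul_X_mem [IsAlgClosed k] (hε : C.IsOrderSequence ε) (hr : ε (Fin.last n) = p ^ r)
    (ha : ∀ i, (a i).IsHomogeneous d) {i₀ : Fin (n + 1)} (ha₀ : a i₀ ∉ C.ideal)
    (hg : ∀ P H, C.IsGaussImage ε P H → ∀ i l,
      H.rep i * eval P.rep (a l) ^ p ^ r = H.rep l * eval P.rep (a i) ^ p ^ r) :
    ∑ i, a i ^ p ^ r * X i ∈ C.ideal := by
  have hq : p ^ r ≠ 0 := pow_ne_zero _ (Fact.out : p.Prime).ne_zero
  -- The extra factor `a i₀` disposes of the points where `a i₀` vanishes and is removed by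
  -- primality.
  refine (C.isPrime.mem_or_mem (y := a i₀) (mem_ideal_of_eval_eq_zero C hε.2
    ((IsHomogeneous.sum _ _ _ fun l _ => ((ha l).pow _).mul (isHomogeneous_X _ _)).mul (ha i₀))
    fun P hP hPS => ?_)).resolve_right ha₀
  have hPg : P ∈ C.genericPoints ε := by
    by_contra h
    exact hPS ⟨hP, h⟩
  obtain ⟨H, hH⟩ := exists_isGaussImage hPg
  have hHP := onHyperplane_of_one_le_interMult hPg.1 (H := H) (by
    rw [hH.2, hr]
    exact_mod_cast Nat.one_le_iff_ne_zero.2 hq)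
  rw [OnHyperplane] at hHP
  rw [map_mul, map_sum]
  by_cases h0 : eval P.rep (a i₀) = 0
  · rw [h0, mul_zero]
  have hH0 : H.rep i₀ ≠ 0 := by
    intro hH0
    obtain ⟨i, hi⟩ := exists_rep_ne_zero H
    have h1 := hg P H hH i i₀
    rw [hH0, zero_mul] at h1
    exact mul_ne_zero hi (pow_ne_zero _ h0) h1
  have h2 : H.rep i₀ * ∑ i, eval P.rep (a i ^ p ^ r * X i) = 0 := by
    have h3 : eval P.rep (a i₀) ^ p ^ r * ∑ i, H.rep i * P.rep i = 0 := by rw [hHP, mul_zero]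
    rw [← h3, Finset.mul_sum, Finset.mul_sum]
    refine Finset.sum_congr rfl fun i _ => ?_
    rw [map_mul, map_pow, eval_X]
    linear_combination (-P.rep i) * hg P H hH i i₀
  rw [(mul_eq_zero.1 h2).resolve_left hH0, zero_mul]

/-- Two families of forms whose `p ^ r`-th powers define hyperplanes of maximal contact are
proportional on the curve. -/
theorem mul_sub_mul_mem [IsAlgClosed k] [CharP k p] (hε : C.IsOrderSequence ε)
    (hr : ε (Fin.last n) = p ^ r)
    {c : Fin (n + 1) → MvPolynomial (Fin (n + 1)) k}
    (ha : ∀ i, (a i).IsHomogeneous d) (hc : ∀ i, (c i).IsHomogeneous d)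
    (haI : ∑ i, a i ^ p ^ r * X i ∈ C.ideal) (hcI : ∑ i, c i ^ p ^ r * X i ∈ C.ideal)
    (i l : Fin (n + 1)) : c i * a l - c l * a i ∈ C.ideal := by
  refine mem_ideal_of_eval_eq_zero C hε.2 (((hc i).mul (ha l)).sub ((hc l).mul (ha i)))
    fun P hP hPS => ?_
  have hPg : P ∈ C.genericPoints ε := by
    by_contra h
    exact hPS ⟨hP, h⟩
  have hD := hPg.1.2
  obtain ⟨j, hj⟩ := exists_rep_ne_zero P
  have h1 := mul_eq_mul_of_germ_mem_pow hε.1 hPg.2 hP hj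
    (hr ▸ germ_linForm_mem_pow hP hj r hc hcI) (hr ▸ germ_linForm_mem_pow hP hj r ha haI) i l
  rw [hr] at h1
  simp only [map_sub, map_mul]
  -- Uniqueness compares the `q`-th powers of the values; injectivity of Frobenius removes the
  -- exponent.
  refine eq_zero_of_pow_eq_zero (n := p ^ r) ?_
  rw [sub_pow_char_pow, mul_pow, mul_pow, h1, sub_self]

end Gauss


/-! ### Linear automorphisms fixing the separable Gauss map -/

/-- A linear automorphism that fixes the separable Gauss map `γ_s` maps the family of osculating
hyperplanes to another family of hyperplanes of maximal contact. -/
theorem sum_matrix_pow_mul_X_mem {p : ℕ} [Fact p.Prime] [CharP k p] {r : ℕ}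
    {a : Fin (n + 1) → MvPolynomial (Fin (n + 1)) k} {b : MvPolynomial (Fin (n + 1)) k}
    (hb : b ∉ C.ideal) {z : Fin (n + 1) → C.K}
    (hz : ∀ i, (z i : ConeField C.ideal) * toCone C.ideal b = toCone C.ideal (a i))
    {i₀ : Fin (n + 1)} (ha₀ : a i₀ ∉ C.ideal) (haI : ∑ i, a i ^ p ^ r * X i ∈ C.ideal)
    {σ : C.K ≃ₐ[k] C.K} (hσ : ∀ i l, σ (z i / z l) = z i / z l)
    {A B : Matrix (Fin (n + 1)) (Fin (n + 1)) k} (hAB : ∀ i l, B i l ^ p ^ r = A i l)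
    (hA : ∀ i j, toCone C.ideal (X j) ≠ 0 → (σ (C.ratio i j) : ConeField C.ideal) =
        toCone C.ideal (linForm (A i)) / toCone C.ideal (linForm (A j))) :
    ∑ l, (∑ i, MvPolynomial.C (B i l) * a i) ^ p ^ r * X l ∈ C.ideal := by
  obtain ⟨j, hj⟩ := exists_toCone_X_ne_zero C
  have hb0 : toCone C.ideal b ≠ 0 := fun h => hb ((toCone_eq_zero_iff C).1 h)
  have hz0 : (z i₀ : ConeField C.ideal) ≠ 0 := fun h => ha₀ ((toCone_eq_zero_iff C).1 (by
    rw [← hz, h, zero_mul]))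
  have hzz : ∀ i, ((z i₀ : ConeField C.ideal) * toCone C.ideal b) ^ p ^ r *
      (z i / z i₀ : ConeField C.ideal) ^ p ^ r =
        ((z i : ConeField C.ideal) * toCone C.ideal b) ^ p ^ r := fun i => by
    rw [← mul_pow]
    congr 1
    field_simp
  have hfrac : ∀ {u w x y : ConeField C.ideal}, x ≠ 0 → u * x * (w * (y / x)) = u * w * y :=
    fun hx => by field_simp
  -- If this form vanished, division by zero would give `σ 1 = 0`.
  have hLj : toCone C.ideal (linForm (A j)) ≠ 0 := by
    intro h0
    have h1 := hA j j hj
    have h2 : C.ratio j j = 1 := Subtype.ext (div_self hj)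
    rw [h2, map_one, h0, div_zero] at h1
    exact one_ne_zero h1
  -- The relation is normalized by `z i₀` because `σ` is only known to fix the ratios of the `z i`.
  have h1 : ∑ i, (z i / z i₀) ^ p ^ r * C.ratio i j = 0 := by
    have h2 := (toCone_eq_zero_iff C).2 haI
    apply Subtype.ext
    rw [AddSubmonoidClass.coe_finsetSum]
    have h3 : ((z i₀ : ConeField C.ideal) * toCone C.ideal b) ^ p ^ r * toCone C.ideal (X j) *
        ∑ i, (((z i / z i₀) ^ p ^ r * C.ratio i j : C.K) : ConeField C.ideal) = 0 := by
      rw [← h2, map_sum, Finset.mul_sum]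
      refine Finset.sum_congr rfl fun i _ => ?_
      rw [map_mul, map_pow, ← hz]
      change _ * ((z i / z i₀ : ConeField C.ideal) ^ p ^ r *
        (toCone C.ideal (X i) / toCone C.ideal (X j))) = _
      rw [hfrac hj, hzz]
    exact (mul_eq_zero.1 h3).resolve_left
      (mul_ne_zero (pow_ne_zero _ (mul_ne_zero hz0 hb0)) hj)
  have h2 : ∑ i, (z i / z i₀) ^ p ^ r * σ (C.ratio i j) = 0 := by
    rw [← map_zero σ, ← h1, map_sum]
    refine Finset.sum_congr rfl fun i _ => ?_
    rw [map_mul, map_pow, hσ]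
  have h3 : ∑ i, toCone C.ideal (a i) ^ p ^ r * toCone C.ideal (linForm (A i)) = 0 := by
    have h4 := congrArg (Subtype.val : C.K → ConeField C.ideal) h2
    rw [AddSubmonoidClass.coe_finsetSum] at h4
    have h5 : ((z i₀ : ConeField C.ideal) * toCone C.ideal b) ^ p ^ r *
        toCone C.ideal (linForm (A j)) *
        ∑ i, (((z i / z i₀) ^ p ^ r * σ (C.ratio i j) : C.K) : ConeField C.ideal) = 0 := by
      rw [h4]
      exact mul_zero _
    rw [← h5, Finset.mul_sum]
    refine Finset.sum_congr rfl fun i _ => ?_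
    rw [← hz]
    change _ = _ * ((z i / z i₀ : ConeField C.ideal) ^ p ^ r *
      (σ (C.ratio i j) : ConeField C.ideal))
    rw [hA i j hj, hfrac hLj, hzz]
  have h4 : ∑ l, (∑ i, MvPolynomial.C (B i l) * a i) ^ p ^ r * X l =
      ∑ i, a i ^ p ^ r * linForm (A i) := by
    simp only [sum_pow_char_pow, linForm, Finset.mul_sum, Finset.sum_mul]
    rw [Finset.sum_comm]
    refine Finset.sum_congr rfl fun i _ => Finset.sum_congr rfl fun l _ => ?_
    rw [← hAB, mul_pow, map_pow]
    ring
  rw [← toCone_eq_zero_iff, h4, map_sum, ← h3]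
  refine Finset.sum_congr rfl fun i _ => ?_
  rw [map_mul, map_pow]

theorem eq_one_of_scalar {σ : C.K ≃ₐ[k] C.K} {A : Matrix (Fin (n + 1)) (Fin (n + 1)) k} {c : k}
    (hc : c ≠ 0) (hAc : A = Matrix.scalar _ c)
    (hA : ∀ i j, toCone C.ideal (X j) ≠ 0 → (σ (C.ratio i j) : ConeField C.ideal) =
        toCone C.ideal (linForm (A i)) / toCone C.ideal (linForm (A j))) : σ = 1 := by
  have hform : ∀ i, toCone C.ideal (linForm (A i)) =
      algebraMap k _ c * toCone C.ideal (X i) := by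
    intro i
    have h1 : A i = c • Pi.single i (1 : k) := by
      funext l
      simp [hAc, Matrix.diagonal_apply, Pi.single_apply, eq_comm]
    rw [h1, linForm_smul, linForm_single, map_mul]
    congr 1
  have hc' : algebraMap k (ConeField C.ideal) c ≠ 0 := by simpa using hc
  have h1 : (σ : C.K →ₐ[k] C.K) = AlgHom.id k C.K := by
    refine IntermediateField.adjoin_algHom_ext _ fun x hx => ?_
    obtain ⟨i, j, rfl⟩ := hx
    change σ (C.ratio i j) = C.ratio i j
    by_cases hj : toCone C.ideal (X j) = 0
    · have h0 : C.ratio i j = 0 := Subtype.ext (by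
        change toCone C.ideal (X i) / toCone C.ideal (X j) = 0
        rw [hj, div_zero])
      rw [h0, map_zero]
    · apply Subtype.ext
      rw [hA i j hj, hform, hform, mul_div_mul_left _ _ hc']
      rfl
  ext x
  exact congrArg Subtype.val (DFunLike.congr_fun h1 x)

/-- A nontrivial linear automorphism that fixes `γ_s` yields a linear relation between the
coordinates of `γ_s`. -/
theorem exists_sum_mul_mem [IsAlgClosed k] {p : ℕ} [Fact p.Prime] [CharP k p]
    {ε : Fin (n + 1) → ℕ} (hε : C.IsOrderSequence ε) {r : ℕ} (hr : ε (Fin.last n) = p ^ r) {d : ℕ}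
    {a : Fin (n + 1) → MvPolynomial (Fin (n + 1)) k} {b : MvPolynomial (Fin (n + 1)) k}
    (ha : ∀ i, (a i).IsHomogeneous d) (hb : b ∉ C.ideal) {z : Fin (n + 1) → C.K}
    (hz : ∀ i, (z i : ConeField C.ideal) * toCone C.ideal b = toCone C.ideal (a i))
    {i₀ : Fin (n + 1)} (ha₀ : a i₀ ∉ C.ideal) (haI : ∑ i, a i ^ p ^ r * X i ∈ C.ideal)
    {σ : C.K ≃ₐ[k] C.K} (hσ : ∀ i l, σ (z i / z l) = z i / z l) (hσ1 : σ ≠ 1)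
    (hlin : C.IsLinearAut σ) :
    ∃ v : Fin (n + 1) → k, v ≠ 0 ∧ ∑ i, MvPolynomial.C (v i) * a i ∈ C.ideal := by
  obtain ⟨A, -, hA⟩ := hlin
  have hq : p ^ r ≠ 0 := pow_ne_zero _ (Fact.out : p.Prime).ne_zero
  -- The roots are taken entry by entry, so that Frobenius carries `Bᵀ a` to the coefficients of the
  -- transformed relation.
  choose B hAB using fun i l => IsAlgClosed.exists_pow_nat_eq (A.1 i l) (Nat.pos_of_ne_zero hq)
  have hcI := sum_matrix_pow_mul_X_mem hb hz ha₀ haI hσ hAB hA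
  have hc : ∀ l, (∑ i, MvPolynomial.C (B i l) * a i).IsHomogeneous d := fun l =>
    IsHomogeneous.sum _ _ _ fun i _ => (ha i).C_mul _
  have hprop := mul_sub_mul_mem hε hr ha hc haI hcI
  have ha₀' : toCone C.ideal (a i₀) ≠ 0 := fun h => ha₀ ((toCone_eq_zero_iff C).1 h)
  have hCk : ∀ c : k, toCone C.ideal (MvPolynomial.C c) = algebraMap k _ c :=
    fun c => (toCone C.ideal).commutes c
  set u : Fin (n + 1) → ConeField C.ideal := fun i => toCone C.ideal (a i) with hu
  have hBu : ∀ l, toCone C.ideal (∑ i, MvPolynomial.C (B i l) * a i) =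
      ∑ i, algebraMap k _ (B i l) * u i := fun l => by simp [hCk, hu]
  obtain ⟨μ, hμ⟩ := exists_algebraMap_eq_of_mulVec_eq_smul (Matrix.of B).transpose
    (u := u) (t := toCone C.ideal (∑ i, MvPolynomial.C (B i i₀) * a i) / u i₀)
    (fun h => ha₀' (congrFun h i₀)) (by
      funext l
      have h1 := (toCone_eq_zero_iff C).2 (hprop l i₀)
      rw [map_sub, map_mul, map_mul, sub_eq_zero] at h1
      rw [Pi.smul_apply, smul_eq_mul, div_mul_eq_mul_div, eq_div_iff ha₀', ← h1, hBu]
      rfl)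
  -- A nonzero column of `B - μ` is the required relation. If there is none, `A` is the scalar `μ ^
  -- q`, which acts trivially on ratios of coordinates.
  by_cases hscal : ∃ l, (fun i => B i l - if i = l then μ else 0) ≠ 0
  · obtain ⟨l, hl⟩ := hscal
    refine ⟨_, hl, ?_⟩
    rw [← toCone_eq_zero_iff]
    have h1 := (toCone_eq_zero_iff C).2 (hprop l i₀)
    rw [map_sub, map_mul, map_mul, sub_eq_zero] at h1
    have h2 : toCone C.ideal (∑ i, MvPolynomial.C (B i l) * a i) = algebraMap k _ μ * u l := by
      rw [hμ, div_mul_eq_mul_div, eq_div_iff ha₀']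
      exact h1
    rw [hBu] at h2
    simp only [map_sum, map_mul, hCk, map_sub, sub_mul, Finset.sum_sub_distrib]
    rw [h2]
    simp [apply_ite, ite_mul, hu]
  · exfalso
    push Not at hscal
    have hB : ∀ i l, B i l = if i = l then μ else 0 := fun i l =>
      sub_eq_zero.1 (congrFun (hscal l) i)
    have hAs : A.1 = Matrix.scalar _ (μ ^ p ^ r) := by
      ext i l
      rw [← hAB, hB, Matrix.scalar_apply, Matrix.diagonal_apply]
      split_ifs
      · rfl
      · exact zero_pow hq
    refine hσ1 (eq_one_of_scalar (fun h0 => ?_) hAs hA)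
    rw [h0, map_zero] at hAs
    exact A.ne_zero hAs

/-! ### Plane curves: cross products and strangeness -/

/-- The rows are the components of `x ↦ x × ν`, that is, three lines through the point `ν`. Any two
of them sharing a nonzero entry `ν l` already span all lines through that point. -/
theorem exists_combination_of_sum_mul_eq_zero {k : Type*} [Field k] {ν w : Fin 3 → k} (hν : ν ≠ 0)
    (h : ∑ i, w i * ν i = 0) : ∃ t : Fin 3 → k,
      w = ∑ i, t i • (![![0, ν 2, -ν 1], ![-ν 2, 0, ν 0], ![ν 1, -ν 0, 0]] :
        Fin 3 → Fin 3 → k) i := by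
  rw [Fin.sum_univ_three] at h
  obtain ⟨l, hl⟩ : ∃ l, ν l ≠ 0 := by
    by_contra! h0
    exact hν (funext h0)
  fin_cases l
  · refine ⟨![0, w 2 / ν 0, -w 1 / ν 0], ?_⟩
    simp only [Fin.zero_eta] at hl
    funext i
    fin_cases i <;> simp [Fin.sum_univ_three] <;> field_simp
    linear_combination h
  · refine ⟨![-w 2 / ν 1, 0, w 0 / ν 1], ?_⟩
    simp only [Fin.mk_one] at hl
    funext i
    fin_cases i <;> simp [Fin.sum_univ_three] <;> field_simp
    linear_combination h
  · refine ⟨![w 1 / ν 2, -w 0 / ν 2, 0], ?_⟩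
    simp only [Fin.reduceFinMk] at hl
    funext i
    fin_cases i <;> simp [Fin.sum_univ_three] <;> field_simp
    linear_combination h

/-- A vector orthogonal to both `x` and `ν` is parallel to `L = x × ν`. -/
theorem cross_mul_eq {R : Type*} [CommRing R] {ν x α : Fin 3 → R} (h : ∑ i, α i * x i = 0)
    (h' : ∑ i, ν i * α i = 0) {L : Fin 3 → R}
    (hL : ∀ i, L i = ∑ l, (![![0, ν 2, -ν 1], ![-ν 2, 0, ν 0], ![ν 1, -ν 0, 0]] :
        Fin 3 → Fin 3 → R) i l * x l) (i l : Fin 3) : L i * α l = L l * α i := by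
  rw [Fin.sum_univ_three] at h h'
  rw [hL, hL]
  fin_cases i <;> fin_cases l <;> simp [Fin.sum_univ_three]
  · linear_combination ν 2 * h - x 2 * h'
  · linear_combination x 1 * h' - ν 1 * h
  · linear_combination x 2 * h' - ν 2 * h
  · linear_combination ν 0 * h - x 0 * h'
  · linear_combination ν 1 * h - x 1 * h'
  · linear_combination x 0 * h' - ν 0 * h

theorem mul_eq_mul_of_cross_eq_zero {k : Type*} [Field k] {x ν : Fin 3 → k}
    (h : ∀ m, eval x (linForm ((![![0, ν 2, -ν 1], ![-ν 2, 0, ν 0], ![ν 1, -ν 0, 0]] :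
        Fin 3 → Fin 3 → k) m)) = 0) (j m : Fin 3) : x j * ν m = ν j * x m := by
  have e0 := h 0
  have e1 := h 1
  have e2 := h 2
  rw [eval_linForm, Fin.sum_univ_three] at e0 e1 e2
  simp at e0 e1 e2
  fin_cases j <;> fin_cases m <;> simp <;> first
    | ring1
    | linear_combination e0
    | linear_combination e1
    | linear_combination e2
    | linear_combination -e0
    | linear_combination -e1
    | linear_combination -e2

/-- Modulo `J`, the combination is a constant multiple of `L m`. Since `ρ` does not kill `L m`, that
constant is zero. -/
theorem sum_smul_mem_of_map_eq_zero {k R ι : Type*} [Field k] [CommRing R] [Algebra k R]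
    [Fintype ι] (ρ : R →ₐ[k] k) {J : Ideal R} (hJ : ∀ f ∈ J, ρ f = 0) {L : ι → R} {c t : ι → k}
    {m : ι} (hm : ρ (L m) ≠ 0) (h : ∀ i, L i - c i • L m ∈ J) (h0 : ρ (∑ i, t i • L i) = 0) :
    ∑ i, t i • L i ∈ J := by
  have h1 : ∑ i, t i • L i = ∑ i, t i • (L i - c i • L m) + (∑ i, t i * c i) • L m := by
    simp only [smul_sub, Finset.sum_sub_distrib, smul_smul, Finset.sum_smul, sub_add_cancel]
  have h2 : ∑ i, t i • (L i - c i • L m) ∈ J := Ideal.sum_mem _ fun i _ => by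
    rw [Algebra.smul_def]
    exact Ideal.mul_mem_left _ _ (h i)
  rw [h1, map_add, hJ _ h2, zero_add, map_smul, smul_eq_mul] at h0
  rw [h1, (mul_eq_zero.1 h0).resolve_right hm, zero_smul, add_zero]
  exact h2

set_option maxHeartbeats 1000000 in
/-- A plane curve is strange if the coordinates of its Gauss map are `p ^ r`-th powers, `r > 0`,
and satisfy a linear relation. -/
theorem isStrange_of_sum_mul_pow_mem {C : ProjCurve k 2} {p : ℕ} [Fact p.Prime] [CharP k p] {r : ℕ}
    (hr : 2 ≤ p ^ r) {d : ℕ} {a : Fin 3 → MvPolynomial (Fin 3) k}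
    (ha : ∀ i, (a i).IsHomogeneous d) {i₀ : Fin 3} (ha₀ : a i₀ ∉ C.ideal)
    (haI : ∑ i, a i ^ p ^ r * X i ∈ C.ideal) {N : PSpace k 2}
    (hN : ∑ i, MvPolynomial.C (N.rep i) * a i ^ p ^ r ∈ C.ideal) : C.IsStrange := by
  refine ⟨N, fun P hPns H hH => ?_⟩
  by_contra hHN
  rw [OnHyperplane] at hHN
  have hHP := onHyperplane_of_one_le_interMult hPns (H := H) (le_trans (by norm_num) hH)
  rw [OnHyperplane] at hHP
  obtain ⟨hP, hD⟩ := hPns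
  obtain ⟨j, hj⟩ := exists_rep_ne_zero P
  set ν := N.rep with hν
  set ℓ : Fin 3 → Fin 3 → k := ![![0, ν 2, -ν 1], ![-ν 2, 0, ν 0], ![ν 1, -ν 0, 0]] with hℓ
  have : CharP (C.localRing P) p :=
    charP_of_injective_algebraMap (algebraMap k (C.localRing P)).injective p
  -- The line `H` contains `P` but not `N`, so `P ≠ N` and some `ℓ m` misses `P`.
  obtain ⟨m, hm⟩ : ∃ m, eval P.rep (linForm (ℓ m)) ≠ 0 := by
    by_contra! h0
    have h2 : P.rep j * ∑ i, H.rep i * ν i = ν j * ∑ i, H.rep i * P.rep i := by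
      rw [Finset.mul_sum, Finset.mul_sum]
      refine Finset.sum_congr rfl fun i _ => ?_
      linear_combination H.rep i * mul_eq_mul_of_cross_eq_zero h0 j i
    rw [hHP, mul_zero] at h2
    exact mul_ne_zero hj hHN h2
  have hL := cross_mul_eq (R := C.localRing P) (ν := fun i => algebraMap k _ (ν i))
    (x := fun i => germ hP hj (X i)) (α := fun i => germ hP hj (a i) ^ p ^ r)
    (L := fun i => germ hP hj (linForm (ℓ i)))
    (by
      have h1 := (germ_eq_zero_iff hP hj (IsHomogeneous.sum _ _ _ fun l _ =>
        ((ha l).pow (p ^ r)).mul (isHomogeneous_X _ _))).2 haI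
      simpa only [map_sum, map_mul, map_pow] using h1)
    (by
      have h1 := (germ_eq_zero_iff hP hj (IsHomogeneous.sum _ _ _ fun l _ =>
        ((ha l).pow (p ^ r)).C_mul _)).2 hN
      simp only [map_sum, map_mul, map_pow] at h1
      rw [← h1]
      refine Finset.sum_congr rfl fun i _ => ?_
      congr 1
      exact ((germ hP hj).commutes _).symm)
    (fun i => by
      rw [germ_linForm]
      refine Finset.sum_congr rfl fun l _ => ?_
      rw [Algebra.smul_def]
      congr 1
      fin_cases i <;> fin_cases l <;> simp [hℓ])
  have ha₀' : germ hP hj (a i₀) ≠ 0 := fun h => ha₀ ((germ_eq_zero_iff hP hj (ha i₀)).1 h)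
  choose c hc using exists_sub_smul_mem_pow (k := k) r (fun f => ⟨_, sub_residue_mem hP f⟩) hL ha₀'
    (isUnit_germ hP hj (isHomogeneous_linForm _) hm)
  have hH2 := (natCast_le_interMult_iff hP hj H 2).1 (by exact_mod_cast hH)
  obtain ⟨v, hv, hv2⟩ := exists_linForm_germ_notMem_sq hP hj
  -- Subtracting a multiple of `H`, we reduce to lines through `N`.
  set e : k := (∑ i, v i * ν i) / ∑ i, H.rep i * ν i with he
  obtain ⟨t, ht⟩ := exists_combination_of_sum_mul_eq_zero (ν := ν) (w := v - e • H.rep)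
    N.rep_nonzero (by
      simp only [Pi.sub_apply, Pi.smul_apply, smul_eq_mul, sub_mul, Finset.sum_sub_distrib,
        mul_assoc, ← Finset.mul_sum]
      rw [he, div_mul_cancel₀ _ hHN, sub_self])
  have hw : linForm (v - e • H.rep) = linForm v - MvPolynomial.C e * linForm H.rep := by
    rw [linForm_sub, linForm_smul]
  have hw0 : residue hP (germ hP hj (linForm (v - e • H.rep))) = 0 := by
    rw [residue_germ_of_isHomogeneous hP hj (isHomogeneous_linForm _), hw, map_sub, map_mul, hv,
      eval_linForm _ H.rep, hHP, mul_zero, sub_zero, mul_zero]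
  -- This line passes through both `N` and `P`, so its contact is at least `q ≥ 2`. As `H` also has
  -- contact at least two, so does `v`, contrary to its choice.
  have hw2 : germ hP hj (linForm (v - e • H.rep)) ∈
      IsLocalRing.maximalIdeal (C.localRing P) ^ 2 := by
    rw [ht, germ_linForm_sum_smul] at hw0 ⊢
    refine sum_smul_mem_of_map_eq_zero (residue hP)
      (fun f hf => (mem_maximalIdeal_iff hP).1 (Ideal.pow_le_self two_ne_zero hf))
      ((isUnit_germ hP hj (isHomogeneous_linForm _) hm).map (residue hP)).ne_zero
      (fun i => Ideal.pow_le_pow_right hr (hc i)) hw0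
  refine hv2 ?_
  have hv' : germ hP hj (linForm v) = germ hP hj (linForm (v - e • H.rep)) +
      germ hP hj (MvPolynomial.C e) * germ hP hj (linForm H.rep) := by
    rw [hw, map_sub, map_mul, sub_add_cancel]
  rw [hv']
  exact Ideal.add_mem _ hw2 (Ideal.mul_mem_left _ _ hH2)

end ProjCurve

/-! ### Proof of the theorem -/

open ProjCurve in
theorem isDegenerate_strictDual_and_isStrange {F : Type*} [Field F] {k : Type*} [Field k]
    [Algebra F k] [IsAlgClosure F k]
    (p : ℕ) [Fact p.Prime] [CharP F p] (n : ℕ)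
    (C : ProjCurve k n)
    (ε : Fin (n + 1) → ℕ) (hε : C.IsOrderSequence ε)
    (r : ℕ) (hr : ε (Fin.last n) = p ^ r)
    (z : Fin (n + 1) → C.K) (hz : C.IsSeparableGauss ε p r z)
    (G : Subgroup (C.K ≃ₐ[k] C.K)) (hG : G ≠ ⊥) (hlin : ∀ σ ∈ G, C.IsLinearAut σ)
    (hsub : C.imageField z ≤ IntermediateField.fixedField G) :
    IsDegenerate (C.strictDual ε) ∧ (n = 2 → C.IsStrange) := by
  have : IsAlgClosed k := IsAlgClosure.isAlgClosed F
  have : CharP k p := charP_of_injective_algebraMap (algebraMap F k).injective p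
  have hq : p ^ r ≠ 0 := pow_ne_zero _ (Fact.out : p.Prime).ne_zero
  obtain ⟨d, a, b, ha, hb, hbI, hzb⟩ := exists_common_denominator C z
  have hb0 : toCone C.ideal b ≠ 0 := fun h => hbI ((toCone_eq_zero_iff C).1 h)
  have hgauss : ∀ P H, C.IsGaussImage ε P H → ∀ i l,
      H.rep i * eval P.rep (a l) ^ p ^ r = H.rep l * eval P.rep (a i) ^ p ^ r :=
    fun P H h => (hz.gauss P H h).mul_pow_eq h.1.1.1 ha hzb
  -- Without generic points the curve would have finitely many points, and the constant `1` would
  -- lie in its ideal.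
  obtain ⟨P, hP⟩ : (C.genericPoints ε).Nonempty := by
    by_contra! h
    have h1 := mem_ideal_of_eval_eq_zero C hε.2 (isHomogeneous_one _ _)
      fun P hP hPS => (hPS ⟨hP, by simp [h]⟩).elim
    exact C.isPrime.ne_top ((Ideal.eq_top_iff_one _).2 h1)
  -- Otherwise every `z i` is zero, and the Gauss image of `P` would have all coordinates zero.
  obtain ⟨i₀, hi₀⟩ : ∃ i, a i ∉ C.ideal := by
    by_contra! h
    obtain ⟨H, hH⟩ := exists_isGaussImage hP
    obtain ⟨j, hj⟩ := exists_rep_ne_zero H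
    obtain ⟨g, hg⟩ := hz.gauss P H hH
    have hz0 : z j = 0 := by
      have h1 := hzb j
      rw [(toCone_eq_zero_iff C).2 (h j)] at h1
      exact Subtype.ext ((mul_eq_zero.1 h1).resolve_right hb0)
    have h2 := hg j
    simp only [hz0, zero_pow hq, mul_zero] at h2
    exact hj (h2.unique hP.1.1 (by simpa using hasValueAt_algebraMap (C := C) (P := P) 0))
  have haI := sum_pow_mul_X_mem hε hr ha hi₀ hgauss
  obtain ⟨σ, hσG, hσ1⟩ := (Subgroup.bot_or_exists_ne_one G).resolve_left hG
  have hσ : ∀ i l, σ (z i / z l) = z i / z l := fun i l =>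
    hsub (IntermediateField.subset_adjoin k _ ⟨i, l, rfl⟩) ⟨σ, hσG⟩
  obtain ⟨v, hv, hvI⟩ := exists_sum_mul_mem hε hr ha hbI hzb hi₀ haI hσ hσ1 (hlin σ hσG)
  have hCk : ∀ c : k, toCone C.ideal (MvPolynomial.C c) = algebraMap k _ c :=
    fun c => (toCone C.ideal).commutes c
  have hvz : ∑ i, v i • z i = 0 := by
    apply Subtype.ext
    rw [AddSubmonoidClass.coe_finsetSum]
    refine (mul_eq_zero.1 ?_).resolve_right hb0
    rw [← (toCone_eq_zero_iff C).2 hvI, map_sum, Finset.sum_mul]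
    refine Finset.sum_congr rfl fun i _ => ?_
    rw [map_mul, hCk, ← hzb, ← mul_assoc, ← Algebra.smul_def]
    rfl
  have hv0 : (fun i => v i ^ p ^ r) ≠ 0 := fun h =>
    hv (funext fun i => eq_zero_of_pow_eq_zero (congrFun h i))
  refine ⟨⟨fun i => v i ^ p ^ r, hv0, fun Q hQ => ?_⟩, ?_⟩
  · rw [← eval_linForm]
    refine hQ 1 _ (isHomogeneous_linForm _) fun H ⟨P, hPH⟩ => ?_
    rw [eval_linForm]
    exact (hz.gauss P H hPH).sum_pow_mul_eq_zero hPH.1.1.1 hvz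
  · rintro rfl
    -- For `n = 2`, three strictly increasing orders force `ε_2 ≥ 2`.
    have hε2 : 2 ≤ p ^ r := by
      rw [← hr]
      have h1 : ε 0 < ε 1 := hε.1 (by decide)
      have h2 : ε 1 < ε (Fin.last 2) := hε.1 (by decide)
      omega
    obtain ⟨t, ht⟩ := Projectivization.exists_smul_eq_mk_rep k _ hv0
    refine isStrange_of_sum_mul_pow_mem hε2 ha hi₀ haI (N := Projectivization.mk k _ hv0) ?_
    -- The chosen representative of `N` is `t` times the vector of the `v i ^ q`, so its relation is
    -- `t` times the `q`-th power of the relation for `v`.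
    have h1 : ∑ i, MvPolynomial.C ((Projectivization.mk k _ hv0).rep i) * a i ^ p ^ r =
        MvPolynomial.C (t : k) * (∑ i, MvPolynomial.C (v i) * a i) ^ p ^ r := by
      rw [sum_pow_char_pow, Finset.mul_sum]
      refine Finset.sum_congr rfl fun i _ => ?_
      rw [← ht, mul_pow, ← mul_assoc, ← map_pow, ← map_mul]
      rfl
    rw [h1]
    exact Ideal.mul_mem_left _ _ (Ideal.pow_mem_of_mem _ hvI _ (Nat.pos_of_ne_zero hq))

end StrictDual

end

theorem mainTheorem5
    {F : Type*} [Field F] [Finite F] {k : Type*} [Field k] [Algebra F k] [IsAlgClosure F k]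
    (p : ℕ) [Fact p.Prime] [CharP F p] (n : ℕ)
    (C : StrictDual.ProjCurve k n) (hC : C.IsDefinedOver F)
    (ε : Fin (n + 1) → ℕ) (hε : C.IsOrderSequence ε)
    (r : ℕ) (hr : ε (Fin.last n) = p ^ r)
    (z : Fin (n + 1) → C.K) (hz : C.IsSeparableGauss ε p r z)
    (G : Subgroup (C.K ≃ₐ[k] C.K)) (hG : G ≠ ⊥) (hlin : ∀ σ ∈ G, C.IsLinearAut σ)
    (hsub : C.imageField z ≤ IntermediateField.fixedField G) :
    StrictDual.IsDegenerate (C.strictDual ε) ∧ (n = 2 → C.IsStrange) :=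
  StrictDual.isDegenerate_strictDual_and_isStrange (F := F) p n C ε hε r hr z hz G hG hlin hsub
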